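/- **Setting.** A *filtration* $\mathbb X$ is an infinite rooted ordered tree in which every vertex has finitely many children, with weights $w(v)>0$ such that the root has weight $1$ and every vertex $v$ that is not a leaf has at least two children, whose weights add up to $w(v)$. The root is identified with $[0,1)$ and, recursively, if $v$ is identified with $[a,a+w(v))$ and has the children $u_0,\dots,u_{m-1}$ from left to right, then $u_j$ is identified with $[a+P_j,a+P_{j+1})$, where $P_k=\sum_{i<k}w(u_i)$. For $1\le k\le m-1$ put $\phi_k(v,\cdot)=w(u_k)\mathbf 1_{[a,a+P_k)}-P_k\mathbf 1_{[a+P_k,a+P_{k+1})}$. Number the root by $0$, and then the vertices that are not the left-most child of their parent by $1,2,\dots$, level by level and from left to right in each level. Let $\psi_0=1$, and for $n\ge1$ let $\psi_n$ be $\phi_\ell(v,\cdot)$ divided by its $L^2([0,1))$ norm, if vertex number $n$ is the child $u_\ell$ of $v$. Let $\mathbb X_1,\mathbb X_2$ be two filtrations with systems $\psi_{n,1}$, $\psi_{n,2}$, let $\mathbb G\subseteq[0,1)^2$, and let $\nu^*$ be a probability measure on $\mathbb G$ such that $\nu^*(\mathbb G\cap(v_1\times v_2))=w(v_1)w(v_2)$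 for all vertices $v_1$ of $\mathbb X_1$, $v_2$ of $\mathbb X_2$ for which $v_1\times v_2$ meets $\mathbb G$. For $\mathbf k=(k_1,k_2)\in\mathbb Z_+^2$ let $\psi_{\mathbf k}(\mathbf x)=\psi_{k_1,1}(x_1)\psi_{k_2,2}(x_2)$, $\Omega=\{\mathbf k:\psi_{\mathbf k}|_{\mathbb G}\not\equiv0\}$ and $\hat f(\mathbf k)=\int_{\mathbb G}f\psi_{\mathbf k}\,d\nu^*$. Let $\|\cdot\|$ be the uniform norm on $\mathbb G$ and $\mathcal F$ the closure of $\mathrm{span}\{\psi_{\mathbf k}|_{\mathbb G}:\mathbf k\in\Omega\}$ in it. For $h:\mathbb Z_+^2\to\mathbb R$ let $\Delta_1h(\mathbf k)=h(k_1+1,k_2)-h(\mathbf k)$, $\Delta_2h(\mathbf k)=h(k_1,k_2+1)-h(\mathbf k)$ and $$\mathcal V(h)=\sup_{\mathbf k}|h(\mathbf k)|+\sup_{k_1}\sum_{k_2}|\Delta_2h(\mathbf k)|+\sup_{k_2}\sum_{k_1}|\Delta_1h(\mathbf k)|+\sum_{\mathbf k}|\Delta_1\Delta_2h(\mathbf k)|.$$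 Let $g_j:\Omega\to[0,1]$, $j\ge0$, be an admissible partition of unity: each $g_j$ has finite support, $g_0(\mathbf 0)=1$, $\sum_jg_j(\mathbf k)=1$ for $\mathbf k\in\Omega$, and for some integer $m^*\ge0$, $g_jg_{j'}=0$ whenever $|j-j'|>m^*$; extend $g_j$ by $0$ to $\mathbb Z_+^2$. Put $H_n=\sum_{j=0}^ng_j$, $\mathbb P_n=\mathrm{span}\{\psi_{\mathbf k}|_{\mathbb G}:\mathbf k\in\Omega,\ H_n(\mathbf k)>0\}$, $E_n(f)=\inf_{P\in\mathbb P_n}\|f-P\|$, $\sigma_n(f)=\sum_{\mathbf k\in\Omega}H_n(\mathbf k)\hat f(\mathbf k)\psi_{\mathbf k}$, $\tau_0(f)=\sigma_0(f)$, and $\tau_j(f)=\sigma_j(f)-\sigma_{j-1}(f)$ for $j\ge1$. Let $r\ge1$ be an integer and $\mu:\mathbb Z_+^2\to\mathbb R$ a multiplier sequence of order $r$: $\mu(\mathbf k)>0$ for every $\mathbf k$ with $|\mathbf k-\mathbf m|_\infty\le2$ for some $\mathbf m\in\Omega$, and, if $\mu_j$ equals $\mu$ on the support of $g_j$ and $0$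 elsewhere, and $\mu_j^{[-1]}$ equals $1/\mu_j$ where $\mu_j\ne0$ and $0$ elsewhere, then $\mathcal V(\mu_j)$ and $\mathcal V(\mu_j^{[-1]})^{-1}$ lie between constant positive multiples of $2^{jr}$, with constants independent of $j$. Write $\mathcal Du$ for a function on $\mathbb G$ with $\widehat{\mathcal Du}(\mathbf k)=\mu(\mathbf k)\hat u(\mathbf k)$ for all $\mathbf k$, and let $K(f,\delta)=\inf\{\|f-u\|+\delta^r\|\mathcal Du\|:u,\mathcal Du\in\mathcal F\}$. For $0<\rho\le\infty$ and $\gamma>0$ let $\mathsf b_{\rho,\gamma}$ be the set of sequences $\{a_n\}_{n\ge0}$ with $\sum_n2^{n\gamma\rho}|a_n|^\rho<\infty$ (with $\sup_n2^{n\gamma}|a_n|<\infty$ if $\rho=\infty$), and let $B_{\rho,\gamma}=\{f\in\mathcal F:\{E_n(f)\}_{n\ge0}\in\mathsf b_{\rho,\gamma}\}$. **Theorem.** Let $0<\rho\le\infty$ and $\gamma>0$, suppose that $\sup_{n\ge1}\mathcal V(H_n)<\infty$, and let $f\in\mathcal F$. The following are equivalent: 1. $f\in B_{\rho,\gamma}$;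 2. $\{\|\tau_j(f)\|\}_{j\ge0}\in\mathsf b_{\rho,\gamma}$; 3. $\{\|f-\sigma_n(f)\|\}_{n\ge0}\in\mathsf b_{\rho,\gamma}$. If moreover $\gamma<r$, they are also equivalent to 4. $\{K(f,2^{-j})\}_{j\ge0}\in\mathsf b_{\rho,\gamma}$. -/

import Mathlib

open MeasureTheory
open scoped ENNReal NNReal

noncomputable section

namespace DigraphHarmonic

/-! ### Filtrations (weighted trees) and tree polynomials -/

/-- An ordered weighted tree in which every vertex has finitely many children. Vertices are
addresses: the root is `[]`, and the children of `v`, from left to right, are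
`0 :: v, 1 :: v, …, (arity v - 1) :: v`. Only the addresses singled out by `TreeData.IsVertex` are
vertices of the tree; the values of `arity` and `w` at other addresses are irrelevant. -/
structure TreeData where
  arity : List ℕ → ℕ
  w : List ℕ → ℝ

namespace TreeData

variable (T : TreeData)

def IsVertex : List ℕ → Prop
  | [] => True
  | i :: v => i < T.arity v ∧ IsVertex v

/-- Left endpoint of the interval associated with a vertex. -/
def left : List ℕ → ℝ
  | [] => 0
  | i :: v => left v + ∑ k ∈ Finset.range i, T.w (k :: v)

/-- The subinterval `[a, a + w(v))` of `[0,1)` associated with the vertex `v`. -/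
def interval (v : List ℕ) : Set ℝ := Set.Ico (T.left v) (T.left v + T.w v)

/-- `P_k(v) = p_0 + ⋯ + p_{k-1}`, where `p_j` is the weight of the `j`-th child of `v`. -/
def cumWeight (v : List ℕ) (k : ℕ) : ℝ := ∑ j ∈ Finset.range k, T.w (j :: v)

/-- The local tree polynomials: `φ_0 = 1_v` and `φ_k = p_k 1_{J_k} - P_k 1_{I_k}` for `k ≥ 1`, with
`J_k = [a, a + P_k)` and `I_k = [a + P_k, a + P_{k+1})`, extended by `0` outside `v`. -/
def localPoly (v : List ℕ) : ℕ → ℝ → ℝ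
  | 0 => (T.interval v).indicator 1
  | k + 1 => fun x =>
      T.w ((k + 1) :: v) *
          (Set.Ico (T.left v) (T.left v + T.cumWeight v (k + 1))).indicator 1 x
        - T.cumWeight v (k + 1) *
          (Set.Ico (T.left v + T.cumWeight v (k + 1))
            (T.left v + T.cumWeight v (k + 2))).indicator 1 x

/-- The vertices at level `L`, from left to right. -/
def level : ℕ → List (List ℕ)
  | 0 => [[]]
  | L + 1 => (level L).flatMap fun v => (List.range (T.arity v)).map fun i => i :: v

/-- `C_0 = {root}`, and `C_L` for `L ≥ 1`: the vertices at level `L` that are not the left-most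
child of their parent, from left to right. -/
def lloLevel : ℕ → List (List ℕ)
  | 0 => [[]]
  | L + 1 => (T.level (L + 1)).filter fun u => u.head? ≠ some 0

/-- The concatenation of `C_0, C_1, …, C_L`. -/
def lloPrefix (L : ℕ) : List (List ℕ) := (List.range (L + 1)).flatMap T.lloLevel

/-- The vertex with number `n` in the leave-left-out enumeration. In an infinite filtration no
`C_L` is empty, so that `C_0, …, C_n` together have more than `n` elements and the default value
is never taken. -/
def lloVertex (n : ℕ) : List ℕ := (T.lloPrefix n).getD n []

/-- The tree polynomials before normalization: `ψ_0 = 1`, and `ψ_n = φ_ℓ(v, ·)` if the `n`-th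
vertex is the `ℓ`-th child of `v`. -/
def psi (n : ℕ) (x : ℝ) : ℝ :=
  match T.lloVertex n with
  | [] => 1
  | l :: v => T.localPoly v l x

/-- The tree polynomials, normalized in `L²([0,1))`. -/
def psiN (n : ℕ) (x : ℝ) : ℝ :=
  T.psi n x / Real.sqrt (∫ t in Set.Ico (0 : ℝ) 1, T.psi n t ^ 2)

end TreeData

/-- An infinite filtration. -/
structure Filtration extends TreeData where
  w_pos : ∀ v, toTreeData.IsVertex v → 0 < w v
  w_root : w [] = 1
  /-- A vertex which is not a leaf has at least two children. -/
  two_le_arity : ∀ v, toTreeData.IsVertex v → arity v ≠ 0 → 2 ≤ arity v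
  /-- The weights of the children of a non-leaf vertex add up to its weight. -/
  w_children : ∀ v, toTreeData.IsVertex v → arity v ≠ 0 →
    ∑ i ∈ Finset.range (arity v), w (i :: v) = w v
  infinite : {v | toTreeData.IsVertex v}.Infinite

/-! ### The digraph as a subset of the square -/

/-- A digraph represented by a pair of filtrations: the set `G ⊆ [0,1)²` of points that correspond
to the nodes of the digraph, and the probability measure `ν` on `G` which gives to the points of `G`
in `v₁ × v₂`, if there are any, the weight `w(v₁) w(v₂)`. -/
structure DigraphRep where
  X₁ : Filtration
  X₂ : Filtration
  G : Set (ℝ × ℝ)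
  G_subset : G ⊆ Set.Ico 0 1 ×ˢ Set.Ico 0 1
  ν : Measure G
  prob : IsProbabilityMeasure ν
  weight : ∀ v₁ v₂, X₁.IsVertex v₁ → X₂.IsVertex v₂ →
    (G ∩ X₁.interval v₁ ×ˢ X₂.interval v₂).Nonempty →
    ν {x | (x : ℝ × ℝ) ∈ X₁.interval v₁ ×ˢ X₂.interval v₂} = ENNReal.ofReal (X₁.w v₁ * X₂.w v₂)

/-- The uniform norm. -/
def supNorm {α : Type*} (f : α → ℝ) : ℝ≥0∞ := ⨆ x, ‖f x‖ₑ

namespace DigraphRep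

variable (D : DigraphRep)

/-- The tensor product tree polynomial `ψ_k`, restricted to `G`. -/
def psi (k : ℕ × ℕ) : D.G → ℝ := fun x => D.X₁.psiN k.1 x.1.1 * D.X₂.psiN k.2 x.1.2

/-- `Ω`: the multi-indices `k` for which `ψ_k` does not vanish identically on `G`. -/
def Omega : Set (ℕ × ℕ) := {k | D.psi k ≠ 0}

/-- `𝓕`: the uniform closure on `G` of the span of `ψ_k`, `k ∈ Ω`. -/
def F : Set (D.G → ℝ) :=
  {f | ∀ ε > 0, ∃ P ∈ Submodule.span ℝ (D.psi '' D.Omega), supNorm (f - P) ≤ ε}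

/-- The Fourier coefficients (they vanish for `k ∉ Ω`). -/
def coeff (f : D.G → ℝ) (k : ℕ × ℕ) : ℝ := ∫ x, f x * D.psi k x ∂D.ν

end DigraphRep

/-! ### Bi-sequences -/

def diff₁ (h : ℕ × ℕ → ℝ) (k : ℕ × ℕ) : ℝ := h (k.1 + 1, k.2) - h k

def diff₂ (h : ℕ × ℕ → ℝ) (k : ℕ × ℕ) : ℝ := h (k.1, k.2 + 1) - h k

/-- The Hardy–Krause type variation of a bi-sequence. -/
def variation (h : ℕ × ℕ → ℝ) : ℝ≥0∞ :=
  (⨆ k, ‖h k‖ₑ) + (⨆ k₁, ∑' k₂, ‖diff₂ h (k₁, k₂)‖ₑ) + (⨆ k₂, ∑' k₁, ‖diff₁ h (k₁, k₂)‖ₑ)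
    + ∑' k, ‖diff₁ (diff₂ h) k‖ₑ

/-- `{k : |k - m|_∞ ≤ 2 for some m ∈ S}`. -/
def enlarge (S : Set (ℕ × ℕ)) : Set (ℕ × ℕ) :=
  {k | ∃ m ∈ S, |(k.1 : ℤ) - m.1| ≤ 2 ∧ |(k.2 : ℤ) - m.2| ≤ 2}

/-- An admissible partition of unity on `Ω`; the sequences are extended by `0` outside `Ω`. -/
structure IsAdmissible (Ω : Set (ℕ × ℕ)) (g : ℕ → ℕ × ℕ → ℝ) : Prop where
  mem_Icc : ∀ j k, g j k ∈ Set.Icc (0 : ℝ) 1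
  eq_zero : ∀ j k, k ∉ Ω → g j k = 0
  zero_zero : g 0 (0, 0) = 1
  finite_support : ∀ j, (Function.support (g j)).Finite
  hasSum : ∀ k ∈ Ω, HasSum (fun j => g j k) 1
  almost_disjoint : ∃ m : ℕ, ∀ j j', j + m < j' → ∀ k, g j k * g j' k = 0

/-- `μ_j`: the restriction of `μ` to the support of `g_j`, with value `0` outside. -/
def restrictTo (g : ℕ → ℕ × ℕ → ℝ) (μ : ℕ × ℕ → ℝ) (j : ℕ) : ℕ × ℕ → ℝ :=
  (Function.support (g j)).indicator μ

/-- `h^{[-1]}`: the reciprocal where `h` is not `0`, and `0` elsewhere (as `0⁻¹ = 0`). -/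
def recip (h : ℕ × ℕ → ℝ) : ℕ × ℕ → ℝ := fun k => (h k)⁻¹

/-- A multiplier sequence of order `r`: positive on the enlargement of `Ω`, with `V(μ_j)` and
`1 / V(μ_j^{[-1]})` comparable to `2^{jr}`, uniformly in `j`. -/
structure IsMultiplier (Ω : Set (ℕ × ℕ)) (g : ℕ → ℕ × ℕ → ℝ) (r : ℕ) (μ : ℕ × ℕ → ℝ) : Prop where
  pos : ∀ k ∈ enlarge Ω, 0 < μ k
  equiv : ∃ c C : ℝ≥0, 0 < c ∧ ∀ j : ℕ,
    c * 2 ^ (j * r) ≤ variation (restrictTo g μ j) ∧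
    variation (restrictTo g μ j) ≤ C * 2 ^ (j * r) ∧
    c * 2 ^ (j * r) ≤ (variation (recip (restrictTo g μ j)))⁻¹ ∧
    (variation (recip (restrictTo g μ j)))⁻¹ ≤ C * 2 ^ (j * r)

/-- `H_n = g_0 + ⋯ + g_n`. -/
def partialSum (g : ℕ → ℕ × ℕ → ℝ) (n : ℕ) (k : ℕ × ℕ) : ℝ := ∑ j ∈ Finset.range (n + 1), g j k

/-- The (quasi-)norm `‖a‖_{ρ,γ}` of a sequence of numbers in `[0,∞]`. -/
def seqNorm (ρ : ℝ≥0∞) (γ : ℝ) (a : ℕ → ℝ≥0∞) : ℝ≥0∞ :=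
  if ρ = ∞ then ⨆ n : ℕ, (2 : ℝ≥0∞) ^ (n * γ) * a n
  else (∑' n : ℕ, (2 : ℝ≥0∞) ^ (n * γ * ρ.toReal) * a n ^ ρ.toReal) ^ (1 / ρ.toReal)

/-- `𝖻_{ρ,γ}`. -/
def seqSpace (ρ : ℝ≥0∞) (γ : ℝ) : Set (ℕ → ℝ≥0∞) := {a | seqNorm ρ γ a < ∞}

namespace DigraphRep

variable (D : DigraphRep)

/-- `ℙ_n`: the tree polynomials of degree at most `n` with respect to `g`. -/
def polys (g : ℕ → ℕ × ℕ → ℝ) (n : ℕ) : Submodule ℝ (D.G → ℝ) :=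
  Submodule.span ℝ (D.psi '' {k | k ∈ D.Omega ∧ 0 < partialSum g n k})

/-- The degree of approximation `E_n(f)`. -/
def degApprox (g : ℕ → ℕ × ℕ → ℝ) (n : ℕ) (f : D.G → ℝ) : ℝ≥0∞ :=
  ⨅ P ∈ D.polys g n, supNorm (f - P)

/-- The reconstruction operator `σ_n` (a finite sum, as the `g_j` have finite support). -/
def sigma (g : ℕ → ℕ × ℕ → ℝ) (n : ℕ) (f : D.G → ℝ) : D.G → ℝ :=
  ∑ᶠ k ∈ D.Omega, (partialSum g n k * D.coeff f k) • D.psi k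

/-- The analysis operator `τ_j`. -/
def tau (g : ℕ → ℕ × ℕ → ℝ) : ℕ → (D.G → ℝ) → (D.G → ℝ)
  | 0, f => D.sigma g 0 f
  | j + 1, f => D.sigma g (j + 1) f - D.sigma g j f

/-- The smoothness class `B_{ρ,γ}`. -/
def besov (g : ℕ → ℕ × ℕ → ℝ) (ρ : ℝ≥0∞) (γ : ℝ) : Set (D.G → ℝ) :=
  {f | f ∈ D.F ∧ (fun n => D.degApprox g n f) ∈ seqSpace ρ γ}

/-- `f'` is a derivative of `f` in the sense of the multiplier sequence `μ`. -/
def IsDerivative (μ : ℕ × ℕ → ℝ) (f f' : D.G → ℝ) : Prop :=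
  ∀ k, D.coeff f' k = μ k * D.coeff f k

/-- The `K`-functional: the infimum of `‖f - u‖ + δ^r ‖𝒟u‖` over all `u ∈ 𝓕` with `𝒟u ∈ 𝓕`. -/
def kFunctional (μ : ℕ × ℕ → ℝ) (r : ℕ) (f : D.G → ℝ) (δ : ℝ) : ℝ≥0∞ :=
  ⨅ (u ∈ D.F) (u' ∈ D.F) (_ : D.IsDerivative μ u u'),
    supNorm (f - u) + ENNReal.ofReal (δ ^ r) * supNorm u'

end DigraphRep

end DigraphHarmonic

end

/-! The measure `ν` gives every rectangle of vertices the product of their weights, so that the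
functions `ψ_k` are orthonormal on the digraph and `Ω` is all of `ℕ × ℕ`. In one variable, the
kernel of a partial sum of the orthogonal expansion is the averaging kernel of a partition of
`[0,1)`, up to one vertex which is only partly subdivided, and so it is dominated by a step function
with integral at most `3`. Rectangular partial sums on the digraph therefore have norm at most
`9`, and summation by parts bounds the multiplier operator with symbol `h` by `9 * variation h`.

Consequently the operators `σ_n` are uniformly bounded. Since `σ_{n + m}`, with `m` the overlap of
the partition of unity, reproduces the polynomials of order `n`, the error `‖f - σ_{n + m}(f)‖` is
at most a constant multiple of `E_n(f)`. The errors are controlled by tails of `∑ ‖τ_j(f)‖`, and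
discrete Hardy inequalities turn such bounds into equivalences of sequence norms. For the
`K`-functional they are combined with the Favard estimate `‖τ_j(u)‖ ≲ 2 ^ (-j r) ‖𝒟u‖` and the
Bernstein estimate `‖𝒟σ_n(f)‖ ≲ ∑_{j ≤ n} 2 ^ (j r) ‖τ_j(f)‖`.
-/

noncomputable section

namespace DigraphHarmonic

/-! ### Step functions on a tree -/

lemma exists_cons_suffix {α : Type*} {u v : List α} (h : u <:+ v) (hne : u ≠ v) :
    ∃ j, (j :: u) <:+ v := by
  obtain ⟨t, rfl⟩ := h
  induction t using List.reverseRecOn with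
  | nil => simp at hne
  | append_singleton t j _ => exact ⟨j, t, by simp⟩

namespace TreeData

variable (T : TreeData)

/-- The indicator function of the interval of a vertex. -/
def cell (v : List ℕ) : ℝ → ℝ := (T.interval v).indicator 1

/-- The indicator function of the union of the first `m` children of a vertex, written as a sum of
cells so that it makes sense in trees whose weights are not additive. -/
def firstCells (v : List ℕ) (m : ℕ) : ℝ → ℝ := ∑ i ∈ Finset.range m, T.cell (i :: v)

/-- The step functions of a tree: the linear combinations of indicators of vertices. -/
def stepFun : Submodule ℝ (ℝ → ℝ) := Submodule.span ℝ (T.cell '' {v | T.IsVertex v})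

variable {T} {u v : List ℕ} {x : ℝ}

lemma cell_of_mem (h : x ∈ T.interval v) : T.cell v x = 1 := Set.indicator_of_mem h 1

lemma cell_nonneg (v : List ℕ) : 0 ≤ T.cell v := fun x =>
  Set.indicator_nonneg (fun _ _ => zero_le_one) x

lemma cell_mul_of_subset (h : T.interval v ⊆ T.interval u) : T.cell u * T.cell v = T.cell v := by
  rw [cell, cell, ← Set.inter_indicator_one, Set.inter_eq_right.2 h]

lemma cell_mul_self (v : List ℕ) : T.cell v * T.cell v = T.cell v := cell_mul_of_subset subset_rfl

lemma cell_mul_of_disjoint (h : Disjoint (T.interval u) (T.interval v)) :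
    T.cell u * T.cell v = 0 := by
  rw [cell, cell, ← Set.inter_indicator_one, h.inter_eq, Set.indicator_empty']

lemma cumWeight_succ (v : List ℕ) (k : ℕ) :
    T.cumWeight v (k + 1) = T.cumWeight v k + T.w (k :: v) := Finset.sum_range_succ _ _

lemma interval_cons (i : ℕ) (v : List ℕ) :
    T.interval (i :: v) =
      Set.Ico (T.left v + T.cumWeight v i) (T.left v + T.cumWeight v (i + 1)) := by
  rw [cumWeight_succ, ← add_assoc]; rfl

lemma firstCells_apply (v : List ℕ) (m : ℕ) (x : ℝ) :
    T.firstCells v m x = ∑ i ∈ Finset.range m, T.cell (i :: v) x := Finset.sum_apply _ _ _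

lemma firstCells_succ (v : List ℕ) (m : ℕ) :
    T.firstCells v (m + 1) = T.firstCells v m + T.cell (m :: v) := Finset.sum_range_succ _ _

lemma firstCells_nonneg (v : List ℕ) (m : ℕ) : 0 ≤ T.firstCells v m :=
  Finset.sum_nonneg fun _ _ => cell_nonneg _

lemma IsVertex.of_suffix (hv : T.IsVertex v) (h : u <:+ v) : T.IsVertex u := by
  induction v with
  | nil => rwa [List.suffix_nil.1 h]
  | cons i v ih =>
    rcases List.suffix_cons_iff.1 h with rfl | h
    · exact hv
    · exact ih hv.2 h

lemma cell_mem_stepFun (hv : T.IsVertex v) : T.cell v ∈ T.stepFun :=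
  Submodule.subset_span ⟨v, hv, rfl⟩

lemma firstCells_mem_stepFun (hv : T.IsVertex v) {m : ℕ} (hm : m ≤ T.arity v) :
    T.firstCells v m ∈ T.stepFun :=
  Submodule.sum_mem _ fun _ hi => cell_mem_stepFun ⟨(Finset.mem_range.1 hi).trans_le hm, hv⟩

lemma measurable_cell (v : List ℕ) : Measurable (T.cell v) :=
  measurable_one.indicator measurableSet_Ico

lemma integrable_cell (v : List ℕ) (P : Measure ℝ) [IsFiniteMeasure P] :
    Integrable (T.cell v) P := (integrable_const (1 : ℝ)).indicator measurableSet_Ico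

lemma measurable_of_mem_stepFun {F : ℝ → ℝ} (hF : F ∈ T.stepFun) : Measurable F := by
  induction hF using Submodule.span_induction with
  | mem F hF => obtain ⟨v, -, rfl⟩ := hF; exact measurable_cell v
  | zero => exact measurable_const
  | add F G _ _ hF hG => exact hF.add hG
  | smul c F _ hF => exact hF.const_smul c

lemma integrable_of_mem_stepFun {F : ℝ → ℝ} (hF : F ∈ T.stepFun) (P : Measure ℝ)
    [IsFiniteMeasure P] : Integrable F P := by
  induction hF using Submodule.span_induction with
  | mem F hF => obtain ⟨v, -, rfl⟩ := hF; exact integrable_cell v P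
  | zero => exact integrable_zero _ _ _
  | add F G _ _ hF hG => exact hF.add hG
  | smul c F _ hF => exact hF.smul c

end TreeData

namespace Filtration

open TreeData

variable {X : Filtration} {u v : List ℕ} {i j k l m : ℕ}

lemma arity_ne_zero (h : X.IsVertex (i :: v)) : X.arity v ≠ 0 := (Nat.zero_lt_of_lt h.1).ne'

lemma cumWeight_arity (hv : X.IsVertex v) (h : X.arity v ≠ 0) :
    X.cumWeight v (X.arity v) = X.w v := X.w_children v hv h

lemma child_w_pos (hv : X.IsVertex v) (hi : i < X.arity v) : 0 < X.w (i :: v) :=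
  X.w_pos _ ⟨hi, hv⟩

lemma cumWeight_mono (hv : X.IsVertex v) (hij : i ≤ j) (hj : j ≤ X.arity v) :
    X.cumWeight v i ≤ X.cumWeight v j :=
  Finset.sum_le_sum_of_subset_of_nonneg (Finset.range_subset_range.2 hij) fun _ hk _ =>
    (child_w_pos hv ((Finset.mem_range.1 hk).trans_le hj)).le

lemma cumWeight_nonneg (hv : X.IsVertex v) (hj : j ≤ X.arity v) : 0 ≤ X.cumWeight v j :=
  Finset.sum_nonneg fun _ hi => (child_w_pos hv ((Finset.mem_range.1 hi).trans_le hj)).le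

lemma cumWeight_succ_pos (hv : X.IsVertex v) (hj : j < X.arity v) :
    0 < X.cumWeight v (j + 1) := by
  rw [cumWeight_succ]
  exact add_pos_of_nonneg_of_pos (cumWeight_nonneg hv hj.le) (child_w_pos hv hj)

lemma firstCells_eq_indicator (hv : X.IsVertex v) (hm : m ≤ X.arity v) :
    X.firstCells v m = (Set.Ico (X.left v) (X.left v + X.cumWeight v m)).indicator 1 := by
  induction m with
  | zero => simp only [firstCells, cumWeight, Finset.sum_range_zero, add_zero, Set.Ico_self,
      Set.indicator_empty']
  | succ m ih =>
    have h_nonneg : 0 ≤ X.cumWeight v m := cumWeight_nonneg hv (Nat.le_of_succ_le hm)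
    have h_mono : X.cumWeight v m ≤ X.cumWeight v (m + 1) := cumWeight_mono hv m.le_succ hm
    rw [firstCells_succ, ih (Nat.le_of_succ_le hm), cell, interval_cons,
      ← Set.Ico_union_Ico_eq_Ico (a := X.left v) (b := X.left v + X.cumWeight v m)
        (c := X.left v + X.cumWeight v (m + 1)) (by linarith) (by gcongr),
      Set.indicator_union_of_disjoint Set.Ico_disjoint_Ico_same]
    rfl

lemma firstCells_arity (hv : X.IsVertex v) (h : X.arity v ≠ 0) :
    X.firstCells v (X.arity v) = X.cell v := by
  rw [firstCells_eq_indicator hv le_rfl, cumWeight_arity hv h]; rfl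

lemma firstCells_le_one (hv : X.IsVertex v) (hm : m ≤ X.arity v) : X.firstCells v m ≤ 1 := by
  rw [firstCells_eq_indicator hv hm]
  exact Set.indicator_le_self' fun _ _ => zero_le_one

lemma firstCells_mul_self (hv : X.IsVertex v) (hm : m ≤ X.arity v) :
    X.firstCells v m * X.firstCells v m = X.firstCells v m := by
  rw [firstCells_eq_indicator hv hm, ← Set.inter_indicator_one, Set.inter_self]

lemma localPoly_succ (hv : X.IsVertex v) (hk : k + 1 < X.arity v) :
    X.localPoly v (k + 1) = X.w ((k + 1) :: v) • X.firstCells v (k + 1)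
      - X.cumWeight v (k + 1) • X.cell ((k + 1) :: v) := by
  rw [firstCells_eq_indicator hv hk.le, cell, interval_cons]; rfl

lemma interval_cons_subset (h : X.IsVertex (i :: v)) : X.interval (i :: v) ⊆ X.interval v := by
  have h_nonneg := cumWeight_nonneg h.2 h.1.le
  have h_mono := cumWeight_mono h.2 (Nat.succ_le_of_lt h.1) le_rfl
  rw [cumWeight_arity h.2 (arity_ne_zero h)] at h_mono
  rw [interval_cons, interval]
  gcongr
  exact le_add_of_nonneg_right h_nonneg

lemma interval_subset_of_suffix (h : u <:+ v) (hv : X.IsVertex v) :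
    X.interval v ⊆ X.interval u := by
  induction v with
  | nil => rw [List.suffix_nil.1 h]
  | cons i v ih =>
    rcases List.suffix_cons_iff.1 h with rfl | h
    · exact subset_rfl
    · exact (interval_cons_subset hv).trans (ih h hv.2)

lemma disjoint_interval_cons (hi : X.IsVertex (i :: v)) (hj : X.IsVertex (j :: v)) (hij : i ≠ j) :
    Disjoint (X.interval (i :: v)) (X.interval (j :: v)) := by
  wlog h : i < j generalizing i j
  · exact (this hj hi hij.symm (by omega)).symm
  rw [interval_cons, interval_cons, Set.Ico_disjoint_Ico]
  have h_mono := cumWeight_mono hi.2 (Nat.succ_le_of_lt h) hj.1.le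
  exact (min_le_left _ _).trans (le_max_of_le_right (by gcongr))

lemma nested_or_disjoint (hu : X.IsVertex u) (hv : X.IsVertex v) :
    u = v ∨ (∃ j, (j :: u) <:+ v) ∨ (∃ j, (j :: v) <:+ u) ∨
      Disjoint (X.interval u) (X.interval v) := by
  induction u with
  | nil =>
    by_cases h : [] = v
    · exact .inl h
    · exact .inr (.inl (exists_cons_suffix List.nil_suffix h))
  | cons i u ih =>
    rcases ih hu.2 with rfl | ⟨j, hj⟩ | ⟨j, hj⟩ | h
    · exact .inr (.inr (.inl ⟨i, List.suffix_rfl⟩))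
    · obtain rfl | hij := eq_or_ne i j
      · by_cases h : i :: u = v
        · exact .inl h
        · exact .inr (.inl (exists_cons_suffix hj h))
      · exact .inr (.inr (.inr ((disjoint_interval_cons hu (hv.of_suffix hj) hij).mono_right
          (interval_subset_of_suffix hj hv))))
    · exact .inr (.inr (.inl ⟨j, hj.trans (List.suffix_cons i u)⟩))
    · exact .inr (.inr (.inr (h.mono_left (interval_cons_subset hu))))

lemma cell_mul_of_suffix (h : u <:+ v) (hv : X.IsVertex v) : X.cell u * X.cell v = X.cell v :=
  cell_mul_of_subset (interval_subset_of_suffix h hv)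

lemma cell_mul_cell_mem_stepFun (hu : X.IsVertex u) (hv : X.IsVertex v) :
    X.cell u * X.cell v ∈ X.stepFun := by
  rcases nested_or_disjoint hu hv with rfl | ⟨j, hj⟩ | ⟨j, hj⟩ | h
  · rw [cell_mul_self]; exact cell_mem_stepFun hu
  · rw [cell_mul_of_suffix ((List.suffix_cons j u).trans hj) hv]; exact cell_mem_stepFun hv
  · rw [mul_comm, cell_mul_of_suffix ((List.suffix_cons j v).trans hj) hu]
    exact cell_mem_stepFun hu
  · rw [cell_mul_of_disjoint h]; exact Submodule.zero_mem _

lemma mul_mem_stepFun {F H : ℝ → ℝ} (hF : F ∈ X.stepFun) (hH : H ∈ X.stepFun) :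
    F * H ∈ X.stepFun := by
  have hmul : X.stepFun * X.stepFun ≤ X.stepFun := by
    rw [stepFun, Submodule.span_mul_span, Submodule.span_le]
    rintro _ ⟨_, ⟨u, hu, rfl⟩, _, ⟨v, hv, rfl⟩, rfl⟩
    exact cell_mul_cell_mem_stepFun hu hv
  exact hmul (Submodule.mul_mem_mul hF hH)

lemma interval_root : X.interval [] = Set.Ico 0 1 := by
  simp only [interval, left, X.w_root, zero_add]

lemma interval_subset_unit (hv : X.IsVertex v) : X.interval v ⊆ Set.Ico 0 1 := by
  rw [← X.interval_root]; exact interval_subset_of_suffix List.nil_suffix hv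

lemma integral_cell (hv : X.IsVertex v) : ∫ x in Set.Ico (0 : ℝ) 1, X.cell v x = X.w v := by
  have h_meas : MeasurableSet (X.interval v) := measurableSet_Ico
  rw [cell, integral_indicator_one h_meas, measureReal_restrict_apply h_meas,
    Set.inter_eq_left.2 (interval_subset_unit hv), interval,
    Real.volume_real_Ico_of_le (le_add_of_nonneg_right (X.w_pos v hv).le), add_sub_cancel_left]

lemma integral_firstCells (hv : X.IsVertex v) (hm : m ≤ X.arity v) :
    ∫ x in Set.Ico (0 : ℝ) 1, X.firstCells v m x = X.cumWeight v m := by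
  simp only [firstCells_apply]
  rw [integral_finsetSum _ fun _ _ => integrable_cell _ _]
  exact Finset.sum_congr rfl fun i hi =>
    integral_cell ⟨(Finset.mem_range.1 hi).trans_le hm, hv⟩

end Filtration

/-! ### Orthogonality of the tree polynomials -/

namespace TreeData

variable (T : TreeData)

/-- The tree polynomial attached to a vertex: `φ_ℓ(v, ·)` for the `ℓ`-th child of `v`, and the
indicator of the root interval for the root. -/
def polyAt : List ℕ → ℝ → ℝ
  | [] => T.cell []
  | l :: v => T.localPoly v l

/-- The square of the `L²` norm of the tree polynomial attached to a vertex, in terms of the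
weights. -/
def normSqAt : List ℕ → ℝ
  | [] => 1
  | l :: v => T.cumWeight v l * T.w (l :: v) * T.cumWeight v (l + 1)

/-- The vertices of the leave-left-out enumeration: the root, and the vertices which are not the
left-most child of their parent. -/
def IsLlo (a : List ℕ) : Prop := T.IsVertex a ∧ a.head? ≠ some 0

variable {T}

lemma isLlo_iff {a : List ℕ} :
    T.IsLlo a ↔ a = [] ∨ ∃ k v, a = (k + 1) :: v ∧ k + 1 < T.arity v ∧ T.IsVertex v := by
  constructor
  · rintro ⟨ha, h_head⟩
    match a, ha, h_head with
    | [], _, _ => exact .inl rfl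
    | 0 :: v, _, h_head => exact absurd rfl h_head
    | (k + 1) :: v, ha, _ => exact .inr ⟨k, v, rfl, ha⟩
  · rintro (rfl | ⟨k, v, rfl, hk, hv⟩)
    · exact ⟨trivial, by simp⟩
    · exact ⟨⟨hk, hv⟩, by simp⟩

end TreeData

namespace Filtration

open TreeData

variable {X : Filtration} {a b u v : List ℕ} {j k l m : ℕ}

lemma normSqAt_pos (ha : X.IsLlo a) : 0 < X.normSqAt a := by
  obtain rfl | ⟨k, v, rfl, hk, hv⟩ := isLlo_iff.1 ha
  · exact one_pos
  · exact mul_pos (mul_pos (cumWeight_succ_pos hv (Nat.lt_of_succ_lt hk)) (child_w_pos hv hk))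
      (cumWeight_succ_pos hv hk)

lemma localPoly_mem_stepFun (hv : X.IsVertex v) (hk : k + 1 < X.arity v) :
    X.localPoly v (k + 1) ∈ X.stepFun := by
  rw [localPoly_succ hv hk]
  exact Submodule.sub_mem _ (Submodule.smul_mem _ _ (firstCells_mem_stepFun hv hk.le))
    (Submodule.smul_mem _ _ (cell_mem_stepFun ⟨hk, hv⟩))

lemma polyAt_mem_stepFun (ha : X.IsLlo a) : X.polyAt a ∈ X.stepFun := by
  obtain rfl | ⟨k, v, rfl, hk, hv⟩ := isLlo_iff.1 ha
  · exact cell_mem_stepFun trivial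
  · exact localPoly_mem_stepFun hv hk

lemma integral_localPoly (hv : X.IsVertex v) (hk : k + 1 < X.arity v) :
    ∫ x in Set.Ico (0 : ℝ) 1, X.localPoly v (k + 1) x = 0 := by
  rw [localPoly_succ hv hk, integral_sub'
    ((integrable_of_mem_stepFun (firstCells_mem_stepFun hv hk.le) _).smul _)
    ((integrable_cell _ _).smul _)]
  simp only [Pi.smul_apply, integral_const_mul, integral_firstCells hv hk.le,
    integral_cell (v := (k + 1) :: v) ⟨hk, hv⟩, smul_eq_mul]
  ring

lemma firstCells_mul_cell (hv : X.IsVertex v) (hm : m ≤ X.arity v) (hj : j < X.arity v) :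
    X.firstCells v m * X.cell (j :: v) = if j < m then X.cell (j :: v) else 0 := by
  have cell_mul_cell : ∀ i ∈ Finset.range m, X.cell (i :: v) * X.cell (j :: v) =
      if i = j then X.cell (j :: v) else 0 := by
    intro i hi
    obtain rfl | hij := eq_or_ne i j
    · rw [cell_mul_self, if_pos rfl]
    · rw [if_neg hij, cell_mul_of_disjoint (disjoint_interval_cons
        ⟨(Finset.mem_range.1 hi).trans_le hm, hv⟩ ⟨hj, hv⟩ hij)]
  rw [firstCells, Finset.sum_mul, Finset.sum_congr rfl cell_mul_cell, Finset.sum_ite_eq']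
  simp only [Finset.mem_range]

lemma exists_localPoly_mul_cell (hv : X.IsVertex v) (hk : k + 1 < X.arity v)
    (hj : j < X.arity v) :
    ∃ c : ℝ, X.localPoly v (k + 1) * X.cell (j :: v) = c • X.cell (j :: v) := by
  have h_cell : X.cell ((k + 1) :: v) = X.firstCells v (k + 2) - X.firstCells v (k + 1) := by
    rw [firstCells_succ, add_sub_cancel_left]
  have exists_smul (p : Prop) [Decidable p] :
      ∃ c : ℝ, (if p then X.cell (j :: v) else 0) = c • X.cell (j :: v) :=
    ⟨if p then 1 else 0, by split_ifs <;> simp⟩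
  obtain ⟨c, hc⟩ := exists_smul (j < k + 1)
  obtain ⟨d, hd⟩ := exists_smul (j < k + 2)
  refine ⟨X.w ((k + 1) :: v) * c - X.cumWeight v (k + 1) * (d - c), ?_⟩
  rw [localPoly_succ hv hk, h_cell, sub_mul, smul_mul_assoc, smul_mul_assoc, sub_mul,
    firstCells_mul_cell hv hk.le hj, firstCells_mul_cell hv hk hj, hc, hd]
  module

lemma cell_mul_localPoly (hv : X.IsVertex v) (hk : k + 1 < X.arity v) (hu : u <:+ v) :
    X.cell u * X.localPoly v (k + 1) = X.localPoly v (k + 1) := by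
  have cell_mul_child : ∀ i < X.arity v, X.cell u * X.cell (i :: v) = X.cell (i :: v) :=
    fun i hi => cell_mul_of_suffix (hu.trans (List.suffix_cons i v)) ⟨hi, hv⟩
  have cell_mul_firstCells : X.cell u * X.firstCells v (k + 1) = X.firstCells v (k + 1) := by
    rw [firstCells, Finset.mul_sum]
    exact Finset.sum_congr rfl fun i hi => cell_mul_child i ((Finset.mem_range.1 hi).trans hk)
  rw [localPoly_succ hv hk, mul_sub, mul_smul_comm, mul_smul_comm, cell_mul_child _ hk,
    cell_mul_firstCells]

lemma localPoly_mul_firstCells (hv : X.IsVertex v) (hmk : m ≤ k + 1) (hk : k + 1 < X.arity v) :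
    X.localPoly v (k + 1) * X.firstCells v m = X.w ((k + 1) :: v) • X.firstCells v m := by
  rw [firstCells, Finset.mul_sum, Finset.smul_sum]
  refine Finset.sum_congr rfl fun i hi => ?_
  have hik : i < k + 1 := (Finset.mem_range.1 hi).trans_le hmk
  have h_disj : X.cell ((k + 1) :: v) * X.cell (i :: v) = 0 := cell_mul_of_disjoint
    (disjoint_interval_cons ⟨hk, hv⟩ ⟨hik.trans hk, hv⟩ hik.ne')
  rw [localPoly_succ hv hk, sub_mul, smul_mul_assoc, smul_mul_assoc, h_disj,
    firstCells_mul_cell hv hk.le (hik.trans hk), if_pos hik, smul_zero, sub_zero]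

lemma localPoly_mul_localPoly_of_lt (hv : X.IsVertex v) (hkl : k < l) (hl : l + 1 < X.arity v) :
    X.localPoly v (l + 1) * X.localPoly v (k + 1) =
      X.w ((l + 1) :: v) • X.localPoly v (k + 1) := by
  have h_cell : X.cell ((k + 1) :: v) = X.firstCells v (k + 2) - X.firstCells v (k + 1) := by
    rw [firstCells_succ, add_sub_cancel_left]
  rw [localPoly_succ hv (k := k) (by omega), h_cell, mul_sub, mul_smul_comm, mul_smul_comm, mul_sub,
    localPoly_mul_firstCells hv (by omega) hl, localPoly_mul_firstCells hv (by omega) hl]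
  module

lemma exists_localPoly_mul_localPoly_of_suffix (hu : X.IsVertex u) (hv : X.IsVertex v)
    (hj : (j :: u) <:+ v) (hk : k + 1 < X.arity u) (hl : l + 1 < X.arity v) :
    ∃ c : ℝ, X.localPoly u (k + 1) * X.localPoly v (l + 1) = c • X.localPoly v (l + 1) := by
  obtain ⟨c, hc⟩ := exists_localPoly_mul_cell hu hk (hv.of_suffix hj).1
  refine ⟨c, ?_⟩
  rw [← cell_mul_localPoly hv hl hj, ← mul_assoc, hc, smul_mul_assoc]

lemma localPoly_mul_localPoly_of_disjoint (hu : X.IsVertex u) (hv : X.IsVertex v)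
    (h : Disjoint (X.interval u) (X.interval v)) (hk : k + 1 < X.arity u)
    (hl : l + 1 < X.arity v) : X.localPoly u (k + 1) * X.localPoly v (l + 1) = 0 := by
  rw [← cell_mul_localPoly hu hk List.suffix_rfl, ← cell_mul_localPoly hv hl List.suffix_rfl,
    mul_mul_mul_comm, cell_mul_of_disjoint h, zero_mul]

/-- One of the two polynomials is constant on the support of the other. -/
lemma exists_localPoly_mul_localPoly (hu : X.IsVertex u) (hv : X.IsVertex v)
    (hk : k + 1 < X.arity u) (hl : l + 1 < X.arity v) (h : (k + 1) :: u ≠ (l + 1) :: v) :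
    ∃ c : ℝ, X.localPoly u (k + 1) * X.localPoly v (l + 1) = c • X.localPoly u (k + 1) ∨
      X.localPoly u (k + 1) * X.localPoly v (l + 1) = c • X.localPoly v (l + 1) := by
  rcases nested_or_disjoint hu hv with rfl | ⟨j, hj⟩ | ⟨j, hj⟩ | h_disj
  · rcases lt_trichotomy k l with hkl | rfl | hlk
    · exact ⟨_, .inl (by rw [mul_comm, localPoly_mul_localPoly_of_lt hu hkl hl])⟩
    · exact absurd rfl h
    · exact ⟨_, .inr (localPoly_mul_localPoly_of_lt hu hlk hk)⟩
  · obtain ⟨c, hc⟩ := exists_localPoly_mul_localPoly_of_suffix hu hv hj hk hl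
    exact ⟨c, .inr hc⟩
  · obtain ⟨c, hc⟩ := exists_localPoly_mul_localPoly_of_suffix hv hu hj hl hk
    exact ⟨c, .inl (by rw [mul_comm, hc])⟩
  · exact ⟨0, .inl (by rw [localPoly_mul_localPoly_of_disjoint hu hv h_disj hk hl, zero_smul])⟩

lemma integral_localPoly_mul_localPoly (hu : X.IsVertex u) (hv : X.IsVertex v)
    (hk : k + 1 < X.arity u) (hl : l + 1 < X.arity v) (h : (k + 1) :: u ≠ (l + 1) :: v) :
    ∫ x in Set.Ico (0 : ℝ) 1, (X.localPoly u (k + 1) * X.localPoly v (l + 1)) x = 0 := by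
  obtain ⟨c, hc | hc⟩ := exists_localPoly_mul_localPoly hu hv hk hl h <;>
    simp only [hc, Pi.smul_apply, integral_smul, integral_localPoly hu hk, integral_localPoly hv hl,
      smul_zero]

lemma integral_polyAt_mul_of_ne (ha : X.IsLlo a) (hb : X.IsLlo b) (hab : a ≠ b) :
    ∫ x in Set.Ico (0 : ℝ) 1, (X.polyAt a * X.polyAt b) x = 0 := by
  obtain rfl | ⟨k, u, rfl, hk, hu⟩ := isLlo_iff.1 ha <;>
    obtain rfl | ⟨l, v, rfl, hl, hv⟩ := isLlo_iff.1 hb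
  · exact absurd rfl hab
  · rw [polyAt, polyAt, cell_mul_localPoly hv hl List.nil_suffix, integral_localPoly hv hl]
  · rw [polyAt, polyAt, mul_comm, cell_mul_localPoly hu hk List.nil_suffix,
      integral_localPoly hu hk]
  · exact integral_localPoly_mul_localPoly hu hv hk hl hab

lemma integral_polyAt_mul_self (ha : X.IsLlo a) :
    ∫ x in Set.Ico (0 : ℝ) 1, (X.polyAt a * X.polyAt a) x = X.normSqAt a := by
  obtain rfl | ⟨k, v, rfl, hk, hv⟩ := isLlo_iff.1 ha
  · rw [polyAt, cell_mul_self, integral_cell ha.1, X.w_root, normSqAt]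
  · have sq_eq : X.polyAt ((k + 1) :: v) * X.polyAt ((k + 1) :: v) =
        X.w ((k + 1) :: v) ^ 2 • X.firstCells v (k + 1)
          + X.cumWeight v (k + 1) ^ 2 • X.cell ((k + 1) :: v) := by
      have h_first := firstCells_mul_self hv hk.le
      have h_mixed := firstCells_mul_cell hv hk.le hk
      rw [if_neg (lt_irrefl _)] at h_mixed
      rw [polyAt, localPoly_succ hv hk]
      simp only [sub_mul, mul_sub, smul_mul_smul_comm, h_first, cell_mul_self, h_mixed,
        mul_comm (X.cell _), smul_zero]
      module
    rw [sq_eq, integral_add'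
      ((integrable_of_mem_stepFun (firstCells_mem_stepFun hv hk.le) _).smul _)
      ((integrable_cell _ _).smul _)]
    simp only [Pi.smul_apply, integral_const_mul, integral_firstCells hv hk.le,
      integral_cell ha.1, normSqAt, cumWeight_succ v (k + 1), smul_eq_mul]
    ring

end Filtration

/-! ### Kernels of one-dimensional partial sums -/

lemma eq_flatMap_or_exists_of_prefix_flatMap {α β : Type*} {φ : α → List β} {t : List α}
    {p : List β} (hp : p <+: t.flatMap φ) :
    p = t.flatMap φ ∨ ∃ t₁ v t₂, t = t₁ ++ v :: t₂ ∧ ∃ s, s <+: φ v ∧ p = t₁.flatMap φ ++ s := by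
  induction t generalizing p with
  | nil => exact .inl (List.prefix_nil.1 hp)
  | cons v t ih =>
    rw [List.flatMap_cons] at hp
    rcases List.prefix_or_prefix_of_prefix hp (List.prefix_append _ _) with h | ⟨p', rfl⟩
    · exact .inr ⟨[], v, t, rfl, p, h, rfl⟩
    · rcases ih ((List.prefix_append_right_inj _).1 hp) with rfl | ⟨t₁, u, t₂, rfl, s, hs, rfl⟩
      · exact .inl List.flatMap_cons.symm
      · exact .inr ⟨v :: t₁, u, t₂, rfl, s, hs, by rw [List.flatMap_cons, List.append_assoc]⟩

namespace TreeData

variable (T : TreeData)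

/-- The kernel `∑ₐ ψ_a(x) ψ_a(y)` of the orthogonal projection onto the span of the normalized tree
polynomials attached to a list of vertices. -/
def kernelSum (p : List (List ℕ)) (x : ℝ) : ℝ → ℝ :=
  (p.map fun a => (T.polyAt a x / T.normSqAt a) • T.polyAt a).sum

/-- The kernel `∑ₐ 1_a(x) 1_a(y) / w(a)` of the averaging operator over a list of vertices. -/
def averageSum (q : List (List ℕ)) (x : ℝ) : ℝ → ℝ :=
  (q.map fun a => (T.cell a x / T.w a) • T.cell a).sum

/-- The number of vertices of a list whose interval contains a point. -/
def coverCount (q : List (List ℕ)) : ℝ → ℝ := (q.map T.cell).sum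

/-- The first `m` children of a vertex (all of them are vertices if `m ≤ arity v`). -/
def firstChildren (v : List ℕ) (m : ℕ) : List (List ℕ) := (List.range m).map (· :: v)

/-- The vertices `1 :: v, …, m :: v`, to which the first `m` tree polynomials at `v` are
attached. -/
def lloSiblings (v : List ℕ) (m : ℕ) : List (List ℕ) := (List.range m).map fun i => (i + 1) :: v

/-- The children of a vertex which belong to the leave-left-out enumeration. -/
def lloChildren (v : List ℕ) : List (List ℕ) := lloSiblings v (T.arity v - 1)

/-- The partition of a vertex into its children; a leaf is not subdivided. -/
def subdivide (v : List ℕ) : List (List ℕ) :=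
  if T.arity v = 0 then [v] else firstChildren v (T.arity v)

/-- The partition of the root into the vertices at level `L` and the leaves at lower levels. -/
def front : ℕ → List (List ℕ)
  | 0 => [[]]
  | L + 1 => (front L).flatMap T.subdivide

/-- Functions whose absolute value is bounded by a step function with integral at most `C`. -/
def IsDominated (C : ℝ) (F : ℝ → ℝ) : Prop :=
  ∃ M ∈ T.stepFun, (∀ y, |F y| ≤ M y) ∧ ∫ y in Set.Ico (0 : ℝ) 1, M y ≤ C

variable {T}

lemma kernelSum_append (p q : List (List ℕ)) (x : ℝ) :
    T.kernelSum (p ++ q) x = T.kernelSum p x + T.kernelSum q x := by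
  rw [kernelSum, List.map_append, List.sum_append]; rfl

lemma averageSum_append (p q : List (List ℕ)) (x : ℝ) :
    T.averageSum (p ++ q) x = T.averageSum p x + T.averageSum q x := by
  rw [averageSum, List.map_append, List.sum_append]; rfl

lemma coverCount_append (p q : List (List ℕ)) :
    T.coverCount (p ++ q) = T.coverCount p + T.coverCount q := by
  rw [coverCount, List.map_append, List.sum_append]; rfl

lemma coverCount_firstChildren (v : List ℕ) (m : ℕ) :
    T.coverCount (firstChildren v m) = T.firstCells v m := by
  rw [coverCount, firstChildren, List.map_map, firstCells, Finset.sum_eq_multiset_sum]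
  rfl

lemma isVertex_of_mem_firstChildren {v a : List ℕ} (hv : T.IsVertex v) {m : ℕ}
    (hm : m ≤ T.arity v) (ha : a ∈ firstChildren v m) : T.IsVertex a := by
  obtain ⟨i, hi, rfl⟩ := List.mem_map.1 ha
  exact ⟨(List.mem_range.1 hi).trans_le hm, hv⟩

lemma isVertex_of_mem_flatMap_subdivide {t : List (List ℕ)} (ht : ∀ v ∈ t, T.IsVertex v)
    {a : List ℕ} (ha : a ∈ t.flatMap T.subdivide) : T.IsVertex a := by
  obtain ⟨v, hv, ha⟩ := List.mem_flatMap.1 ha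
  rw [subdivide] at ha
  split_ifs at ha
  · exact List.mem_singleton.1 ha ▸ ht v hv
  · exact isVertex_of_mem_firstChildren (ht v hv) le_rfl ha

lemma isVertex_of_mem_front {L : ℕ} {a : List ℕ} (ha : a ∈ T.front L) : T.IsVertex a := by
  induction L generalizing a with
  | zero => rw [List.mem_singleton.1 ha]; trivial
  | succ L ih => exact isVertex_of_mem_flatMap_subdivide (fun _ => ih) ha

lemma level_succ (L : ℕ) :
    T.level (L + 1) = (T.level L).flatMap fun v => firstChildren v (T.arity v) := rfl

lemma lloLevel_succ (L : ℕ) : T.lloLevel (L + 1) = (T.level L).flatMap T.lloChildren := by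
  have filter_firstChildren (v : List ℕ) (m : ℕ) :
      (firstChildren v m).filter (fun u => u.head? ≠ some 0) = lloSiblings v (m - 1) := by
    rw [firstChildren, lloSiblings, List.filter_map]
    cases m <;> simp [List.range_succ_eq_map, List.filter_map, Function.comp_def]
  rw [lloLevel, level_succ, List.filter_flatMap]
  simp only [filter_firstChildren]
  rfl

lemma lloPrefix_zero : T.lloPrefix 0 = [[]] := rfl

lemma lloPrefix_succ (L : ℕ) : T.lloPrefix (L + 1) = T.lloPrefix L ++ T.lloLevel (L + 1) := by
  rw [lloPrefix, List.range_succ, List.flatMap_append, List.flatMap_singleton]; rfl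

lemma flatMap_front_eq_flatMap_level {α : Type*} {φ : List ℕ → List α}
    (hφ : ∀ v, T.arity v = 0 → φ v = []) (L : ℕ) :
    (T.front L).flatMap φ = (T.level L).flatMap φ := by
  induction L generalizing φ with
  | zero => rfl
  | succ L ih =>
    have subdivide_flatMap (v : List ℕ) :
        (T.subdivide v).flatMap φ = (firstChildren v (T.arity v)).flatMap φ := by
      rw [subdivide]
      split_ifs with h
      · rw [List.flatMap_singleton, hφ v h, h]; rfl
      · rfl
    rw [front, level_succ, List.flatMap_assoc, List.flatMap_assoc, ih]
    · simp only [subdivide_flatMap]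
    · intro v h
      rw [subdivide_flatMap, h]; rfl

lemma lloLevel_succ_eq_flatMap_front (L : ℕ) :
    T.lloLevel (L + 1) = (T.front L).flatMap T.lloChildren := by
  rw [lloLevel_succ, flatMap_front_eq_flatMap_level]
  intro v h
  rw [lloChildren, h]; rfl

lemma averageSum_mem_stepFun {q : List (List ℕ)} (hq : ∀ a ∈ q, T.IsVertex a) (x : ℝ) :
    T.averageSum q x ∈ T.stepFun := by
  refine list_sum_mem fun F hF => ?_
  obtain ⟨a, ha, rfl⟩ := List.mem_map.1 hF
  exact Submodule.smul_mem _ _ (cell_mem_stepFun (hq a ha))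

lemma isDominated_of_nonneg {F : ℝ → ℝ} (hF : F ∈ T.stepFun) (h_nonneg : 0 ≤ F) {C : ℝ}
    (hC : ∫ y in Set.Ico (0 : ℝ) 1, F y ≤ C) : T.IsDominated C F :=
  ⟨F, hF, fun y => (abs_of_nonneg (h_nonneg y)).le, hC⟩

lemma IsDominated.mono {C C' : ℝ} {F : ℝ → ℝ} (hF : T.IsDominated C F) (h : C ≤ C') :
    T.IsDominated C' F := by
  obtain ⟨M, hM, hFM, h_int⟩ := hF
  exact ⟨M, hM, hFM, h_int.trans h⟩

lemma IsDominated.neg {C : ℝ} {F : ℝ → ℝ} (hF : T.IsDominated C F) : T.IsDominated C (-F) := by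
  obtain ⟨M, hM, hFM, h_int⟩ := hF
  exact ⟨M, hM, fun y => (abs_neg (F y)).trans_le (hFM y), h_int⟩

lemma IsDominated.add {C C' : ℝ} {F F' : ℝ → ℝ} (hF : T.IsDominated C F)
    (hF' : T.IsDominated C' F') : T.IsDominated (C + C') (F + F') := by
  obtain ⟨M, hM, hFM, h_int⟩ := hF
  obtain ⟨M', hM', hFM', h_int'⟩ := hF'
  refine ⟨M + M', Submodule.add_mem _ hM hM',
    fun y => (abs_add_le _ _).trans (add_le_add (hFM y) (hFM' y)), ?_⟩
  rw [integral_add' (integrable_of_mem_stepFun hM _) (integrable_of_mem_stepFun hM' _)]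
  exact add_le_add h_int h_int'

end TreeData

namespace Filtration

open TreeData

variable {X : Filtration} {p q s t : List (List ℕ)} {v : List ℕ} {m L : ℕ} {x : ℝ}

lemma averageSum_nonneg (hq : ∀ a ∈ q, X.IsVertex a) (x : ℝ) : 0 ≤ X.averageSum q x := by
  refine List.sum_nonneg fun F hF => ?_
  obtain ⟨a, ha, rfl⟩ := List.mem_map.1 hF
  exact smul_nonneg (div_nonneg (cell_nonneg a x) (X.w_pos a (hq a ha)).le) (cell_nonneg a)

lemma integral_averageSum (hq : ∀ a ∈ q, X.IsVertex a) (x : ℝ) :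
    ∫ y in Set.Ico (0 : ℝ) 1, X.averageSum q x y = X.coverCount q x := by
  induction q with
  | nil => simp [averageSum, coverCount]
  | cons a q ih =>
    obtain ⟨ha, hq⟩ := List.forall_mem_cons.1 hq
    have averageSum_cons : X.averageSum (a :: q) x =
      (X.cell a x / X.w a) • X.cell a + X.averageSum q x := List.sum_cons
    have coverCount_cons : X.coverCount (a :: q) = X.cell a + X.coverCount q := List.sum_cons
    rw [averageSum_cons, coverCount_cons, integral_add' ((integrable_cell a _).smul _)
      (integrable_of_mem_stepFun (averageSum_mem_stepFun hq x) _), ih hq]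
    simp only [Pi.smul_apply, integral_smul, integral_cell ha]
    rw [smul_eq_mul, div_mul_cancel₀ _ (X.w_pos a ha).ne', Pi.add_apply]

lemma isDominated_averageSum (hq : ∀ a ∈ q, X.IsVertex a) (hx : X.coverCount q x ≤ 1) :
    X.IsDominated 1 (X.averageSum q x) :=
  isDominated_of_nonneg (averageSum_mem_stepFun hq x) (averageSum_nonneg hq x)
    ((integral_averageSum hq x).trans_le hx)

/-- The sum telescopes, as each term is the difference of two consecutive averaging kernels. -/
lemma kernelSum_lloSiblings (hv : X.IsVertex v) (hm : m < X.arity v) (x : ℝ) :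
    X.kernelSum (lloSiblings v m) x = X.averageSum (firstChildren v (m + 1)) x
      - (X.firstCells v (m + 1) x / X.cumWeight v (m + 1)) • X.firstCells v (m + 1) := by
  induction m with
  | zero => simp [lloSiblings, firstChildren, kernelSum, averageSum, firstCells, cumWeight]
  | succ m ih =>
    have lloSiblings_succ : lloSiblings v (m + 1) = lloSiblings v m ++ [(m + 1) :: v] := by
      rw [lloSiblings, List.range_succ, List.map_append]; rfl
    have firstChildren_succ :
        firstChildren v (m + 2) = firstChildren v (m + 1) ++ [(m + 1) :: v] := by
      rw [firstChildren, List.range_succ, List.map_append]; rfl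
    have h_cum : X.cumWeight v (m + 1) ≠ 0 := (cumWeight_succ_pos hv (by omega)).ne'
    have h_cum' : X.cumWeight v (m + 1) + X.w ((m + 1) :: v) ≠ 0 := by
      rw [← cumWeight_succ]; exact (cumWeight_succ_pos hv hm).ne'
    have h_w : X.w ((m + 1) :: v) ≠ 0 := (child_w_pos hv hm).ne'
    rw [lloSiblings_succ, kernelSum_append, ih (by omega), firstChildren_succ, averageSum_append,
      firstCells_succ v (m + 1), cumWeight_succ v (m + 1)]
    ext y
    simp only [kernelSum, averageSum, List.map_singleton, List.sum_singleton, polyAt, normSqAt,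
      localPoly_succ hv hm, cumWeight_succ v (m + 1), Pi.add_apply, Pi.sub_apply, Pi.smul_apply,
      smul_eq_mul]
    field_simp
    ring

lemma averageSum_subdivide (hv : X.IsVertex v) (x : ℝ) :
    X.averageSum (X.subdivide v) x =
      X.averageSum [v] x + X.kernelSum (X.lloChildren v) x := by
  by_cases h : X.arity v = 0
  · simp [subdivide, lloChildren, lloSiblings, h, kernelSum]
  · rw [subdivide, if_neg h, lloChildren, kernelSum_lloSiblings hv (by omega),
      Nat.sub_one_add_one h, firstCells_arity hv h, cumWeight_arity hv h]
    simp [averageSum]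

lemma coverCount_subdivide (hv : X.IsVertex v) :
    X.coverCount (X.subdivide v) = X.cell v := by
  rw [subdivide]
  split_ifs with h
  · exact List.sum_singleton
  · rw [coverCount_firstChildren, firstCells_arity hv h]

lemma averageSum_flatMap_subdivide (ht : ∀ v ∈ t, X.IsVertex v) (x : ℝ) :
    X.averageSum (t.flatMap X.subdivide) x =
      X.averageSum t x + X.kernelSum (t.flatMap X.lloChildren) x := by
  induction t with
  | nil => simp [averageSum, kernelSum]
  | cons v t ih =>
    obtain ⟨hv, ht⟩ := List.forall_mem_cons.1 ht
    rw [List.flatMap_cons, List.flatMap_cons, averageSum_append, kernelSum_append,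
      averageSum_subdivide hv, ih ht, ← List.singleton_append (l := t), averageSum_append]
    abel

lemma coverCount_flatMap_subdivide (ht : ∀ v ∈ t, X.IsVertex v) :
    X.coverCount (t.flatMap X.subdivide) = X.coverCount t := by
  induction t with
  | nil => rfl
  | cons v t ih =>
    obtain ⟨hv, ht⟩ := List.forall_mem_cons.1 ht
    rw [List.flatMap_cons, coverCount_append, coverCount_subdivide hv, ih ht]
    exact List.sum_cons.symm

lemma coverCount_front (X : Filtration) (L : ℕ) : X.coverCount (X.front L) = X.cell [] := by
  induction L with
  | zero => exact List.sum_singleton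
  | succ L ih => rw [front, coverCount_flatMap_subdivide fun _ => isVertex_of_mem_front, ih]

lemma coverCount_front_le_one (X : Filtration) (L : ℕ) (x : ℝ) :
    X.coverCount (X.front L) x ≤ 1 := by
  rw [coverCount_front]
  exact Set.indicator_le_self' (fun _ _ => zero_le_one) x

lemma kernelSum_lloPrefix (X : Filtration) (L : ℕ) (x : ℝ) :
    X.kernelSum (X.lloPrefix L) x = X.averageSum (X.front L) x := by
  induction L with
  | zero => simp [lloPrefix_zero, front, kernelSum, averageSum, polyAt, normSqAt, X.w_root]
  | succ L ih =>
    rw [lloPrefix_succ, kernelSum_append, ih, lloLevel_succ_eq_flatMap_front, front,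
      averageSum_flatMap_subdivide fun _ => isVertex_of_mem_front]

lemma isDominated_kernelSum_of_prefix_lloChildren (hv : X.IsVertex v)
    (hs : s <+: X.lloChildren v) (x : ℝ) : X.IsDominated 2 (X.kernelSum s x) := by
  obtain ⟨m, hm, rfl⟩ : ∃ m ≤ X.arity v - 1, s = lloSiblings v m := by
    rw [List.prefix_iff_eq_take, lloChildren, lloSiblings, ← List.map_take, List.take_range] at hs
    exact ⟨_, min_le_right _ _, hs⟩
  by_cases h : X.arity v = 0
  · obtain rfl : m = 0 := by omega
    exact ⟨0, Submodule.zero_mem _, by simp [lloSiblings, kernelSum], by simp⟩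
  have hm' : m + 1 ≤ X.arity v := by omega
  have h_average : X.IsDominated 1 (X.averageSum (firstChildren v (m + 1)) x) := by
    refine isDominated_averageSum (fun a => isVertex_of_mem_firstChildren hv hm') ?_
    rw [coverCount_firstChildren]
    exact firstCells_le_one hv hm' x
  have h_first : X.IsDominated 1
      ((X.firstCells v (m + 1) x / X.cumWeight v (m + 1)) • X.firstCells v (m + 1)) := by
    have h_cum := cumWeight_succ_pos hv hm'
    refine isDominated_of_nonneg (Submodule.smul_mem _ _ (firstCells_mem_stepFun hv hm'))
      (smul_nonneg (div_nonneg (firstCells_nonneg v _ x) h_cum.le) (firstCells_nonneg v _)) ?_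
    simp only [Pi.smul_apply, integral_smul, integral_firstCells hv hm']
    rw [smul_eq_mul, div_mul_cancel₀ _ h_cum.ne']
    exact firstCells_le_one hv hm' x
  rw [kernelSum_lloSiblings hv (by omega), sub_eq_add_neg]
  exact (h_average.add h_first.neg).mono (by norm_num)

lemma isDominated_averageSum_add_kernelSum (ht : ∀ v ∈ t, X.IsVertex v)
    (hx : X.coverCount t x ≤ 1) (hp : p <+: t.flatMap X.lloChildren) :
    X.IsDominated 3 (X.averageSum t x + X.kernelSum p x) := by
  rcases eq_flatMap_or_exists_of_prefix_flatMap hp with rfl | ⟨t₁, v, t₂, rfl, s, hs, rfl⟩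
  · rw [← averageSum_flatMap_subdivide ht]
    refine (isDominated_averageSum (fun _ => isVertex_of_mem_flatMap_subdivide ht) ?_).mono
      (by norm_num)
    rwa [coverCount_flatMap_subdivide ht]
  · obtain ⟨ht₁, ht₂⟩ := List.forall_mem_append.1 ht
    have h_eq : X.averageSum (t₁ ++ v :: t₂) x + X.kernelSum (t₁.flatMap X.lloChildren ++ s) x =
        X.averageSum (t₁.flatMap X.subdivide ++ v :: t₂) x + X.kernelSum s x := by
      rw [averageSum_append, averageSum_append, kernelSum_append,
        averageSum_flatMap_subdivide ht₁]
      abel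
    rw [h_eq]
    refine ((isDominated_averageSum (List.forall_mem_append.2
      ⟨fun _ => isVertex_of_mem_flatMap_subdivide ht₁, ht₂⟩) ?_).add
      (isDominated_kernelSum_of_prefix_lloChildren (ht₂ v List.mem_cons_self) hs x)).mono
      (by norm_num)
    rwa [coverCount_append, coverCount_flatMap_subdivide ht₁, ← coverCount_append]

lemma isDominated_kernelSum (hp : p <+: X.lloPrefix L) (x : ℝ) :
    X.IsDominated 3 (X.kernelSum p x) := by
  have h_front (L : ℕ) : X.IsDominated 1 (X.averageSum (X.front L) x) :=
    isDominated_averageSum (fun _ => isVertex_of_mem_front) (coverCount_front_le_one X L x)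
  induction L with
  | zero =>
    rcases List.prefix_cons_iff.1 hp with rfl | ⟨p', rfl, hp'⟩
    · exact ⟨0, Submodule.zero_mem _, by simp [kernelSum], by simp⟩
    · rw [List.prefix_nil.1 hp', ← X.lloPrefix_zero, kernelSum_lloPrefix]
      exact (h_front 0).mono (by norm_num)
  | succ L ih =>
    rw [lloPrefix_succ] at hp
    rcases List.prefix_or_prefix_of_prefix hp (List.prefix_append _ _) with h | ⟨p', rfl⟩
    · exact ih h
    · rw [List.prefix_append_right_inj, lloLevel_succ_eq_flatMap_front] at hp
      rw [kernelSum_append, kernelSum_lloPrefix]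
      exact isDominated_averageSum_add_kernelSum (fun _ => isVertex_of_mem_front)
        (coverCount_front_le_one X L x) hp

end Filtration

namespace TreeData

variable {T : TreeData} {L m n : ℕ} {a v : List ℕ}

lemma length_of_mem_level (hv : v ∈ T.level L) : v.length = L := by
  induction L generalizing v with
  | zero => rw [List.mem_singleton.1 hv]; rfl
  | succ L ih =>
    rw [level_succ, List.mem_flatMap] at hv
    obtain ⟨u, hu, hv⟩ := hv
    obtain ⟨i, -, rfl⟩ := List.mem_map.1 hv
    rw [List.length_cons, ih hu]

lemma isVertex_of_mem_level (hv : v ∈ T.level L) : T.IsVertex v := by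
  induction L generalizing v with
  | zero => rw [List.mem_singleton.1 hv]; trivial
  | succ L ih =>
    rw [level_succ, List.mem_flatMap] at hv
    obtain ⟨u, hu, hv⟩ := hv
    exact isVertex_of_mem_firstChildren (ih hu) le_rfl hv

lemma IsVertex.mem_level (hv : T.IsVertex v) : v ∈ T.level v.length := by
  induction v with
  | nil => exact List.mem_singleton.2 rfl
  | cons i v ih =>
    rw [List.length_cons, level_succ, List.mem_flatMap]
    exact ⟨v, ih hv.2, List.mem_map.2 ⟨i, List.mem_range.2 hv.1, rfl⟩⟩

lemma nodup_level (T : TreeData) (L : ℕ) : (T.level L).Nodup := by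
  induction L with
  | zero => exact List.nodup_singleton _
  | succ L ih =>
    rw [level_succ, List.nodup_flatMap]
    refine ⟨fun v _ => List.nodup_range.map fun i j h => (List.cons.inj h).1, ?_⟩
    refine ih.imp fun {u v} huv a hau hav => huv ?_
    obtain ⟨i, -, rfl⟩ := List.mem_map.1 hau
    obtain ⟨j, -, h⟩ := List.mem_map.1 hav
    exact (List.cons.inj h).2.symm

lemma lloLevel_sublist (T : TreeData) (L : ℕ) : (T.lloLevel L).Sublist (T.level L) := by
  cases L with
  | zero => exact List.Sublist.refl _
  | succ L => exact List.filter_sublist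

lemma nodup_lloPrefix (T : TreeData) (L : ℕ) : (T.lloPrefix L).Nodup := by
  rw [lloPrefix, List.nodup_flatMap]
  refine ⟨fun n _ => (T.lloLevel_sublist n).nodup (T.nodup_level n), ?_⟩
  refine List.nodup_range.imp fun {m n} hmn a ham han => hmn ?_
  rw [← length_of_mem_level ((T.lloLevel_sublist m).subset ham),
    length_of_mem_level ((T.lloLevel_sublist n).subset han)]

lemma isLlo_of_mem_lloPrefix (ha : a ∈ T.lloPrefix L) : T.IsLlo a := by
  obtain ⟨n, -, ha⟩ := List.mem_flatMap.1 ha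
  refine ⟨isVertex_of_mem_level ((T.lloLevel_sublist n).subset ha), ?_⟩
  cases n with
  | zero => rw [List.mem_singleton.1 ha]; simp
  | succ n => simpa using (List.mem_filter.1 ha).2

lemma lloPrefix_prefix (h : n ≤ m) : T.lloPrefix n <+: T.lloPrefix m := by
  induction h with
  | refl => exact List.prefix_rfl
  | step _ ih => exact ih.trans (by rw [lloPrefix_succ]; exact List.prefix_append _ _)

end TreeData

namespace Filtration

open TreeData

variable {X : Filtration} {m n : ℕ}

lemma level_ne_nil (X : Filtration) (L : ℕ) : X.level L ≠ [] := by
  intro h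
  have level_add (n : ℕ) : X.level (L + n) = [] := by
    induction n with
    | zero => exact h
    | succ n ih => rw [← add_assoc, level_succ, ih, List.flatMap_nil]
  refine X.infinite (((Set.finite_Iio L).biUnion fun n _ =>
    (X.level n).finite_toSet).subset fun v hv => ?_)
  have hv_level := IsVertex.mem_level hv
  refine Set.mem_biUnion (Set.mem_Iio.2 (not_le.1 fun hL => ?_)) hv_level
  rw [← Nat.add_sub_cancel' hL, level_add] at hv_level
  exact List.not_mem_nil hv_level

lemma lloLevel_ne_nil (X : Filtration) (L : ℕ) : X.lloLevel L ≠ [] := by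
  cases L with
  | zero => exact List.cons_ne_nil _ _
  | succ L =>
    obtain ⟨_, h⟩ := List.exists_mem_of_ne_nil _ (X.level_ne_nil (L + 1))
    obtain ⟨v, hv, h⟩ := List.mem_flatMap.1 h
    obtain ⟨i, hi, rfl⟩ := List.mem_map.1 h
    have two_le := X.two_le_arity v (isVertex_of_mem_level hv)
      (Nat.ne_zero_of_lt (List.mem_range.1 hi))
    rw [lloLevel_succ]
    exact List.ne_nil_of_mem (List.mem_flatMap.2 ⟨v, hv, List.mem_map.2
      ⟨0, List.mem_range.2 (Nat.sub_pos_of_lt two_le), rfl⟩⟩)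

lemma lt_length_lloPrefix (X : Filtration) (n : ℕ) : n < (X.lloPrefix n).length := by
  induction n with
  | zero => exact one_pos
  | succ n ih =>
    rw [lloPrefix_succ, List.length_append]
    have := List.length_pos_iff.2 (X.lloLevel_ne_nil (n + 1))
    omega

lemma lloVertex_eq_getElem (h : n ≤ m) :
    ∃ hn : n < (X.lloPrefix m).length, X.lloVertex n = (X.lloPrefix m)[n] := by
  have hn := X.lt_length_lloPrefix n
  have h_prefix := lloPrefix_prefix (T := X.toTreeData) h
  refine ⟨hn.trans_le h_prefix.length_le, ?_⟩
  rw [lloVertex, List.getD_eq_getElem _ _ hn]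
  exact h_prefix.getElem hn

lemma isLlo_lloVertex (X : Filtration) (n : ℕ) : X.IsLlo (X.lloVertex n) := by
  obtain ⟨hn, h⟩ := lloVertex_eq_getElem (X := X) le_rfl
  rw [h]
  exact isLlo_of_mem_lloPrefix (List.getElem_mem hn)

lemma lloVertex_injective (X : Filtration) : Function.Injective X.lloVertex := by
  intro m n h
  obtain ⟨hm, hm'⟩ := lloVertex_eq_getElem (X := X) (le_max_left m n)
  obtain ⟨hn, hn'⟩ := lloVertex_eq_getElem (X := X) (le_max_right m n)
  rw [hm', hn'] at h
  exact (X.nodup_lloPrefix _).getElem_inj_iff.1 h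

lemma map_lloVertex_range_prefix (X : Filtration) (N : ℕ) :
    (List.range (N + 1)).map X.lloVertex <+: X.lloPrefix N := by
  rw [List.prefix_iff_getElem]
  refine ⟨by simpa using X.lt_length_lloPrefix N, fun i hi => ?_⟩
  rw [List.length_map, List.length_range] at hi
  obtain ⟨_, h⟩ := lloVertex_eq_getElem (X := X) (Nat.le_of_lt_succ hi)
  simpa using h

/-- The normalized tree polynomials, cut off outside `[0,1)`: unlike `psiN 0`, the function
`psiCut 0` is a step function on the whole line. -/
def psiCut (X : Filtration) (n : ℕ) : ℝ → ℝ :=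
  (√(X.normSqAt (X.lloVertex n)))⁻¹ • X.polyAt (X.lloVertex n)

/-- The kernel of the partial sums of the expansion in normalized tree polynomials. -/
def kernel (X : Filtration) (N : ℕ) (x : ℝ) : ℝ → ℝ :=
  ∑ n ∈ Finset.Iic N, X.psiCut n x • X.psiCut n

lemma psi_eq_polyAt (n : ℕ) {x : ℝ} (hx : x ∈ Set.Ico (0 : ℝ) 1) :
    X.psi n x = X.polyAt (X.lloVertex n) x := by
  rw [TreeData.psi]
  split
  · next h => rw [h, polyAt, cell_of_mem (X.interval_root ▸ hx)]
  · next l v h => rw [h, polyAt]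

lemma psiN_eq_psiCut (n : ℕ) {x : ℝ} (hx : x ∈ Set.Ico (0 : ℝ) 1) :
    X.psiN n x = X.psiCut n x := by
  have integral_psi_sq : ∫ t in Set.Ico (0 : ℝ) 1, X.psi n t ^ 2 = X.normSqAt (X.lloVertex n) := by
    rw [← integral_polyAt_mul_self (X.isLlo_lloVertex n)]
    refine setIntegral_congr_fun measurableSet_Ico fun t ht => ?_
    rw [psi_eq_polyAt n ht, sq, Pi.mul_apply]
  rw [psiN, integral_psi_sq, psi_eq_polyAt n hx, div_eq_inv_mul]
  rfl

lemma psiCut_mem_stepFun (X : Filtration) (n : ℕ) : X.psiCut n ∈ X.stepFun :=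
  Submodule.smul_mem _ _ (polyAt_mem_stepFun (X.isLlo_lloVertex n))

lemma integral_psiCut_mul (X : Filtration) (m n : ℕ) :
    ∫ x in Set.Ico (0 : ℝ) 1, (X.psiCut m * X.psiCut n) x = if m = n then 1 else 0 := by
  simp only [psiCut, smul_mul_smul_comm, Pi.smul_apply, integral_smul]
  split_ifs with h
  · have h_pos := normSqAt_pos (X.isLlo_lloVertex n)
    rw [h, integral_polyAt_mul_self (X.isLlo_lloVertex n), ← mul_inv,
      Real.mul_self_sqrt h_pos.le, smul_eq_mul, inv_mul_cancel₀ h_pos.ne']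
  · rw [integral_polyAt_mul_of_ne (X.isLlo_lloVertex m) (X.isLlo_lloVertex n)
      (X.lloVertex_injective.ne h), smul_zero]

lemma kernel_eq_kernelSum (X : Filtration) (N : ℕ) (x : ℝ) :
    X.kernel N x = X.kernelSum ((List.range (N + 1)).map X.lloVertex) x := by
  rw [kernel, kernelSum, List.map_map, ← List.sum_toFinset _ List.nodup_range,
    List.toFinset_range, Nat.range_succ_eq_Iic]
  refine Finset.sum_congr rfl fun n _ => ?_
  rw [psiCut, Pi.smul_apply, smul_eq_mul, smul_smul, mul_right_comm, ← mul_inv,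
    Real.mul_self_sqrt (normSqAt_pos (X.isLlo_lloVertex n)).le, ← div_eq_inv_mul]
  rfl

lemma isDominated_kernel (X : Filtration) (N : ℕ) (x : ℝ) : X.IsDominated 3 (X.kernel N x) := by
  rw [kernel_eq_kernelSum]
  exact isDominated_kernelSum (X.map_lloVertex_range_prefix N) x

end Filtration

/-! ### Integration over the digraph -/

section SupNorm

variable {α : Type*}

lemma enorm_le_supNorm (f : α → ℝ) (x : α) : ‖f x‖ₑ ≤ supNorm f := le_iSup (fun x => ‖f x‖ₑ) x

lemma supNorm_zero : supNorm (0 : α → ℝ) = 0 := by simp [supNorm]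

lemma supNorm_add_le (f g : α → ℝ) : supNorm (f + g) ≤ supNorm f + supNorm g :=
  iSup_le fun x => (enorm_add_le _ _).trans
    (add_le_add (enorm_le_supNorm f x) (enorm_le_supNorm g x))

lemma supNorm_neg (f : α → ℝ) : supNorm (-f) = supNorm f := by simp [supNorm]

lemma supNorm_sub_le (f g : α → ℝ) : supNorm (f - g) ≤ supNorm f + supNorm g := by
  rw [sub_eq_add_neg, ← supNorm_neg g]
  exact supNorm_add_le _ _

lemma supNorm_smul (c : ℝ) (f : α → ℝ) : supNorm (c • f) = ‖c‖ₑ * supNorm f := by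
  simp [supNorm, ENNReal.mul_iSup]

lemma supNorm_sum_le {ι : Type*} (s : Finset ι) (f : ι → α → ℝ) :
    supNorm (∑ i ∈ s, f i) ≤ ∑ i ∈ s, supNorm (f i) :=
  Finset.le_sum_of_subadditive _ supNorm_zero.le supNorm_add_le _ _

lemma supNorm_comp_le {β : Type*} (f : α → ℝ) (φ : β → α) :
    supNorm (fun x => f (φ x)) ≤ supNorm f := iSup_comp_le (‖f ·‖ₑ) φ

lemma supNorm_lt_top_of_mem_span {s : Set (α → ℝ)} (hs : ∀ f ∈ s, supNorm f < ∞) {f : α → ℝ}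
    (hf : f ∈ Submodule.span ℝ s) : supNorm f < ∞ := by
  induction hf using Submodule.span_induction with
  | mem f hf => exact hs f hf
  | zero => exact supNorm_zero.trans_lt ENNReal.zero_lt_top
  | add f g _ _ hf hg => exact (supNorm_add_le f g).trans_lt (ENNReal.add_lt_top.2 ⟨hf, hg⟩)
  | smul c f _ hf => rw [supNorm_smul]; exact ENNReal.mul_lt_top enorm_lt_top hf

lemma integrable_mul_of_supNorm_lt_top [MeasurableSpace α] {P : Measure α} {f g : α → ℝ}
    (hf : Measurable f) (hf_bdd : supNorm f < ∞) (hg : Integrable g P) :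
    Integrable (fun x => f x * g x) P := by
  refine hg.bdd_mul (c := (supNorm f).toReal) hf.aestronglyMeasurable (.of_forall fun x => ?_)
  rw [← toReal_enorm]
  exact ENNReal.toReal_mono hf_bdd.ne (enorm_le_supNorm f x)

end SupNorm

lemma TreeData.supNorm_lt_top_of_mem_stepFun {T : TreeData} {F : ℝ → ℝ} (hF : F ∈ T.stepFun) :
    supNorm F < ∞ := by
  refine supNorm_lt_top_of_mem_span ?_ hF
  rintro _ ⟨v, -, rfl⟩
  refine (iSup_le fun t => ?_).trans_lt ENNReal.one_lt_top
  exact (enorm_indicator_le_enorm_self _ _).trans_eq enorm_one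

namespace DigraphRep

open TreeData Filtration

variable {D : DigraphRep}

instance isProbabilityMeasure_ν : IsProbabilityMeasure D.ν := D.prob

lemma fst_mem_Ico (x : D.G) : x.1.1 ∈ Set.Ico (0 : ℝ) 1 := (D.G_subset x.2).1

lemma snd_mem_Ico (x : D.G) : x.1.2 ∈ Set.Ico (0 : ℝ) 1 := (D.G_subset x.2).2

lemma measurable_fst_val : Measurable fun x : D.G => x.1.1 :=
  measurable_fst.comp measurable_subtype_coe

lemma measurable_snd_val : Measurable fun x : D.G => x.1.2 :=
  measurable_snd.comp measurable_subtype_coe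

/-- The nodes of the digraph in the rectangle `u × v`. -/
def rect (D : DigraphRep) (u v : List ℕ) : Set D.G :=
  {x | (x : ℝ × ℝ) ∈ D.X₁.interval u ×ˢ D.X₂.interval v}

lemma integrable_mul_of_mem_stepFun {F H : ℝ → ℝ} (hF : F ∈ D.X₁.stepFun)
    (hH : H ∈ D.X₂.stepFun) : Integrable (fun x : D.G => F x.1.1 * H x.1.2) D.ν :=
  integrable_mul_of_supNorm_lt_top ((measurable_of_mem_stepFun hF).comp measurable_fst_val)
    ((supNorm_comp_le F _).trans_lt (supNorm_lt_top_of_mem_stepFun hF))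
    ((integrable_of_mem_stepFun hH (D.ν.map fun x : D.G => x.1.2)).comp_measurable
      measurable_snd_val)

lemma integral_cell_mul_cell (u v : List ℕ) :
    ∫ x, D.X₁.cell u x.1.1 * D.X₂.cell v x.1.2 ∂D.ν = D.ν.real (D.rect u v) := by
  have h_meas : MeasurableSet (D.rect u v) :=
    (measurableSet_Ico.prod measurableSet_Ico).preimage measurable_subtype_coe
  rw [← integral_indicator_one h_meas]
  refine integral_congr_ae (.of_forall fun x => ?_)
  by_cases hu : x.1.1 ∈ D.X₁.interval u <;> by_cases hv : x.1.2 ∈ D.X₂.interval v <;>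
    simp [cell, rect, hu, hv, Set.indicator]

section Rectangles

variable {u v : List ℕ} {i : ℕ}

lemma real_rect_le (hu : D.X₁.IsVertex u) (hv : D.X₂.IsVertex v) :
    D.ν.real (D.rect u v) ≤ D.X₁.w u * D.X₂.w v := by
  have h_nonneg : 0 ≤ D.X₁.w u * D.X₂.w v :=
    mul_nonneg (D.X₁.w_pos u hu).le (D.X₂.w_pos v hv).le
  by_cases h : (D.G ∩ D.X₁.interval u ×ˢ D.X₂.interval v).Nonempty
  · rw [Measure.real, rect, D.weight u v hu hv h, ENNReal.toReal_ofReal h_nonneg]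
  · have h_empty : D.rect u v = ∅ :=
      Set.eq_empty_iff_forall_notMem.2 fun x hx => h ⟨x, x.2, hx⟩
    rwa [h_empty, measureReal_empty]

lemma real_rect_root (D : DigraphRep) : D.ν.real (D.rect [] []) = 1 := by
  have h_univ : D.rect [] [] = Set.univ := Set.eq_univ_iff_forall.2 fun x =>
    ⟨D.X₁.interval_root ▸ fst_mem_Ico x, D.X₂.interval_root ▸ snd_mem_Ico x⟩
  rw [h_univ, probReal_univ]

lemma sum_real_rect_cons_left (hu : D.X₁.IsVertex u) (h : D.X₁.arity u ≠ 0)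
    (hv : D.X₂.IsVertex v) :
    ∑ i ∈ Finset.range (D.X₁.arity u), D.ν.real (D.rect (i :: u) v) = D.ν.real (D.rect u v) := by
  simp only [← integral_cell_mul_cell]
  rw [← firstCells_arity hu h, ← integral_finsetSum _ fun i hi => integrable_mul_of_mem_stepFun
    (cell_mem_stepFun (v := i :: u) ⟨Finset.mem_range.1 hi, hu⟩) (cell_mem_stepFun hv)]
  simp only [firstCells, Finset.sum_apply, Finset.sum_mul]

lemma sum_real_rect_cons_right (hu : D.X₁.IsVertex u) (hv : D.X₂.IsVertex v)
    (h : D.X₂.arity v ≠ 0) :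
    ∑ i ∈ Finset.range (D.X₂.arity v), D.ν.real (D.rect u (i :: v)) = D.ν.real (D.rect u v) := by
  simp only [← integral_cell_mul_cell]
  rw [← firstCells_arity hv h, ← integral_finsetSum _ fun i hi => integrable_mul_of_mem_stepFun
    (cell_mem_stepFun hu) (cell_mem_stepFun (v := i :: v) ⟨Finset.mem_range.1 hi, hv⟩)]
  simp only [firstCells, Finset.sum_apply, Finset.mul_sum]

/-- Summed over all children of `u`, the inequalities `real_rect_le` become an equality, so that
each of them is one. -/
lemma real_rect_cons_left (hu : D.X₁.IsVertex (i :: u)) (hv : D.X₂.IsVertex v)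
    (h : D.ν.real (D.rect u v) = D.X₁.w u * D.X₂.w v) :
    D.ν.real (D.rect (i :: u) v) = D.X₁.w (i :: u) * D.X₂.w v := by
  have h_arity := arity_ne_zero hu
  refine (Finset.sum_eq_sum_iff_of_le fun j hj => real_rect_le (u := j :: u)
    ⟨Finset.mem_range.1 hj, hu.2⟩ hv).1 ?_ i (Finset.mem_range.2 hu.1)
  rw [sum_real_rect_cons_left hu.2 h_arity hv, ← Finset.sum_mul,
    D.X₁.w_children u hu.2 h_arity, h]

lemma real_rect_cons_right (hu : D.X₁.IsVertex u) (hv : D.X₂.IsVertex (i :: v))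
    (h : D.ν.real (D.rect u v) = D.X₁.w u * D.X₂.w v) :
    D.ν.real (D.rect u (i :: v)) = D.X₁.w u * D.X₂.w (i :: v) := by
  have h_arity := arity_ne_zero hv
  refine (Finset.sum_eq_sum_iff_of_le fun j hj => real_rect_le (v := j :: v) hu
    ⟨Finset.mem_range.1 hj, hv.2⟩).1 ?_ i (Finset.mem_range.2 hv.1)
  rw [sum_real_rect_cons_right hu hv.2 h_arity, ← Finset.mul_sum,
    D.X₂.w_children v hv.2 h_arity, h]

lemma real_rect (hu : D.X₁.IsVertex u) (hv : D.X₂.IsVertex v) :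
    D.ν.real (D.rect u v) = D.X₁.w u * D.X₂.w v := by
  induction u with
  | nil =>
    induction v with
    | nil => rw [real_rect_root, D.X₁.w_root, D.X₂.w_root, one_mul]
    | cons i v ih => exact real_rect_cons_right hu hv (ih hv.2)
  | cons i u ih => exact real_rect_cons_left hu hv (ih hu.2)

end Rectangles

lemma integral_mul_of_mem_stepFun {F H : ℝ → ℝ} (hF : F ∈ D.X₁.stepFun)
    (hH : H ∈ D.X₂.stepFun) :
    ∫ x, F x.1.1 * H x.1.2 ∂D.ν =
      (∫ t in Set.Ico (0 : ℝ) 1, F t) * ∫ t in Set.Ico (0 : ℝ) 1, H t := by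
  induction hF, hH using Submodule.span_induction₂ with
  | mem_mem F H hF hH =>
    obtain ⟨u, hu, rfl⟩ := hF
    obtain ⟨v, hv, rfl⟩ := hH
    rw [integral_cell_mul_cell, real_rect hu hv, integral_cell hu, integral_cell hv]
  | zero_left => simp
  | zero_right => simp
  | add_left F F' H hF hF' hH h h' =>
    simp only [Pi.add_apply, add_mul]
    rw [integral_add (integrable_mul_of_mem_stepFun hF hH) (integrable_mul_of_mem_stepFun hF' hH),
      h, h', integral_add (integrable_of_mem_stepFun hF _) (integrable_of_mem_stepFun hF' _),
      add_mul]
  | add_right F H H' hF hH hH' h h' =>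
    simp only [Pi.add_apply, mul_add]
    rw [integral_add (integrable_mul_of_mem_stepFun hF hH) (integrable_mul_of_mem_stepFun hF hH'),
      h, h', integral_add (integrable_of_mem_stepFun hH _) (integrable_of_mem_stepFun hH' _),
      mul_add]
  | smul_left c F H _ _ h =>
    simp only [Pi.smul_apply, smul_eq_mul, mul_assoc]
    rw [integral_const_mul, integral_const_mul, h, mul_assoc]
  | smul_right c F H _ _ h =>
    simp only [Pi.smul_apply, smul_eq_mul, mul_left_comm _ c]
    rw [integral_const_mul, integral_const_mul, h, mul_left_comm]

lemma psi_apply (k : ℕ × ℕ) (x : D.G) :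
    D.psi k x = D.X₁.psiCut k.1 x.1.1 * D.X₂.psiCut k.2 x.1.2 := by
  rw [DigraphRep.psi, psiN_eq_psiCut _ (fst_mem_Ico x), psiN_eq_psiCut _ (snd_mem_Ico x)]

lemma integrable_psi (D : DigraphRep) (k : ℕ × ℕ) : Integrable (D.psi k) D.ν := by
  rw [funext (psi_apply k)]
  exact integrable_mul_of_mem_stepFun (psiCut_mem_stepFun _ _) (psiCut_mem_stepFun _ _)

lemma measurable_psi (D : DigraphRep) (k : ℕ × ℕ) : Measurable (D.psi k) := by
  rw [funext (psi_apply k)]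
  exact ((measurable_of_mem_stepFun (psiCut_mem_stepFun _ _)).comp measurable_fst_val).mul
    ((measurable_of_mem_stepFun (psiCut_mem_stepFun _ _)).comp measurable_snd_val)

lemma supNorm_psi_lt_top (D : DigraphRep) (k : ℕ × ℕ) : supNorm (D.psi k) < ∞ := by
  refine (iSup_le fun x => ?_).trans_lt (ENNReal.mul_lt_top
    (supNorm_lt_top_of_mem_stepFun (D.X₁.psiCut_mem_stepFun k.1))
    (supNorm_lt_top_of_mem_stepFun (D.X₂.psiCut_mem_stepFun k.2)))
  rw [psi_apply, enorm_mul]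
  exact mul_le_mul' (enorm_le_supNorm _ _) (enorm_le_supNorm _ _)

lemma coeff_psi (k l : ℕ × ℕ) : D.coeff (D.psi k) l = if k = l then 1 else 0 := by
  have psi_mul_psi (x : D.G) : D.psi k x * D.psi l x =
      (D.X₁.psiCut k.1 * D.X₁.psiCut l.1) x.1.1 * (D.X₂.psiCut k.2 * D.X₂.psiCut l.2) x.1.2 := by
    rw [psi_apply, psi_apply, mul_mul_mul_comm]; rfl
  simp only [coeff, psi_mul_psi]
  rw [integral_mul_of_mem_stepFun (mul_mem_stepFun (psiCut_mem_stepFun _ _)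
    (psiCut_mem_stepFun _ _)) (mul_mem_stepFun (psiCut_mem_stepFun _ _) (psiCut_mem_stepFun _ _)),
    integral_psiCut_mul, integral_psiCut_mul]
  simp only [Prod.ext_iff, ite_and, ite_mul, one_mul, zero_mul]

lemma Omega_eq_univ (D : DigraphRep) : D.Omega = Set.univ := by
  refine Set.eq_univ_iff_forall.2 fun k hk => ?_
  have h := coeff_psi (D := D) k k
  rw [if_pos rfl, hk] at h
  simp [coeff] at h

lemma lintegral_enorm_mul_le {C C' : ℝ} {F H : ℝ → ℝ} (hF : D.X₁.IsDominated C F)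
    (hH : D.X₂.IsDominated C' H) :
    ∫⁻ y, ‖F y.1.1 * H y.1.2‖ₑ ∂D.ν ≤ ENNReal.ofReal (C * C') := by
  obtain ⟨M, hM, hFM, hC⟩ := hF
  obtain ⟨N, hN, hHN, hC'⟩ := hH
  have hM_nonneg (t : ℝ) : 0 ≤ M t := (abs_nonneg _).trans (hFM t)
  have hN_nonneg (t : ℝ) : 0 ≤ N t := (abs_nonneg _).trans (hHN t)
  calc ∫⁻ y, ‖F y.1.1 * H y.1.2‖ₑ ∂D.ν
      ≤ ∫⁻ y, ENNReal.ofReal (M y.1.1 * N y.1.2) ∂D.ν := by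
        refine lintegral_mono fun y => ?_
        rw [Real.enorm_eq_ofReal_abs, abs_mul]
        exact ENNReal.ofReal_le_ofReal
          (mul_le_mul (hFM _) (hHN _) (abs_nonneg _) (hM_nonneg _))
    _ = ENNReal.ofReal (∫ y, M y.1.1 * N y.1.2 ∂D.ν) :=
        (ofReal_integral_eq_lintegral_ofReal (integrable_mul_of_mem_stepFun hM hN)
          (.of_forall fun y => mul_nonneg (hM_nonneg _) (hN_nonneg _))).symm
    _ ≤ ENNReal.ofReal (C * C') := by
        rw [integral_mul_of_mem_stepFun hM hN]
        exact ENNReal.ofReal_le_ofReal (mul_le_mul hC hC' (integral_nonneg hN_nonneg)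
          ((integral_nonneg hM_nonneg).trans hC))

end DigraphRep

/-! ### Orthogonal expansions on the digraph -/

namespace DigraphRep

variable {D : DigraphRep} {f f' : D.G → ℝ} {k m : ℕ × ℕ}

lemma mem_F_of_mem_span {P : D.G → ℝ} (hP : P ∈ Submodule.span ℝ (D.psi '' D.Omega)) :
    P ∈ D.F := fun ε _ => ⟨P, hP, by rw [sub_self, supNorm_zero]; exact zero_le⟩

lemma psi_mem_F (D : DigraphRep) (k : ℕ × ℕ) : D.psi k ∈ D.F :=
  mem_F_of_mem_span (Submodule.subset_span ⟨k, D.Omega_eq_univ ▸ Set.mem_univ k, rfl⟩)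

lemma sub_mem_F (hf : f ∈ D.F) (hf' : f' ∈ D.F) : f - f' ∈ D.F := by
  intro ε hε
  obtain ⟨P, hP, hfP⟩ := hf _ (ENNReal.half_pos hε.ne')
  obtain ⟨P', hP', hfP'⟩ := hf' _ (ENNReal.half_pos hε.ne')
  refine ⟨P - P', Submodule.sub_mem _ hP hP', ?_⟩
  rw [sub_sub_sub_comm]
  exact (supNorm_sub_le _ _).trans ((add_le_add hfP hfP').trans (ENNReal.add_halves ε).le)

lemma supNorm_lt_top_of_mem_F (hf : f ∈ D.F) : supNorm f < ∞ := by
  obtain ⟨P, hP, hfP⟩ := hf 1 one_pos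
  have hP_bdd : supNorm P < ∞ := supNorm_lt_top_of_mem_span
    (by rintro _ ⟨k, -, rfl⟩; exact D.supNorm_psi_lt_top k) hP
  rw [← sub_add_cancel f P]
  exact (supNorm_add_le _ _).trans_lt
    (ENNReal.add_lt_top.2 ⟨hfP.trans_lt ENNReal.one_lt_top, hP_bdd⟩)

lemma measurable_of_mem_span {P : D.G → ℝ} (hP : P ∈ Submodule.span ℝ (D.psi '' D.Omega)) :
    Measurable P := by
  induction hP using Submodule.span_induction with
  | mem P hP =>
    obtain ⟨k, -, rfl⟩ := hP
    exact D.measurable_psi k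
  | zero => exact measurable_const
  | add P Q _ _ hP hQ => exact hP.add hQ
  | smul c P _ hP => exact hP.const_smul c

lemma measurable_of_mem_F (hf : f ∈ D.F) : Measurable f := by
  choose P hP hfP using fun n : ℕ => hf _ (ENNReal.inv_pos.2 (ENNReal.natCast_ne_top n))
  refine measurable_of_tendsto_metrizable (fun n => measurable_of_mem_span (hP n))
    (tendsto_pi_nhds.2 fun x => tendsto_iff_edist_tendsto_0.2 ?_)
  refine tendsto_of_tendsto_of_tendsto_of_le_of_le tendsto_const_nhds
    ENNReal.tendsto_inv_nat_nhds_zero (fun _ => zero_le) fun n => ?_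
  rw [edist_comm, edist_eq_enorm_sub]
  exact (enorm_le_supNorm (f - P n) x).trans (hfP n)

lemma integrable_mul_psi (hf : f ∈ D.F) (k : ℕ × ℕ) :
    Integrable (fun x => f x * D.psi k x) D.ν :=
  integrable_mul_of_supNorm_lt_top (measurable_of_mem_F hf) (supNorm_lt_top_of_mem_F hf)
    (D.integrable_psi k)

lemma coeff_sub (hf : f ∈ D.F) (hf' : f' ∈ D.F) (k : ℕ × ℕ) :
    D.coeff (f - f') k = D.coeff f k - D.coeff f' k := by
  simp only [coeff, Pi.sub_apply, sub_mul]
  exact integral_sub (integrable_mul_psi hf k) (integrable_mul_psi hf' k)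

lemma coeff_sum_smul_psi (s : Finset (ℕ × ℕ)) (c : ℕ × ℕ → ℝ) (l : ℕ × ℕ) :
    D.coeff (∑ k ∈ s, c k • D.psi k) l = if l ∈ s then c l else 0 := by
  have integral_psi_mul_psi (k : ℕ × ℕ) :
      ∫ x, D.psi k x * D.psi l x ∂D.ν = if k = l then 1 else 0 := coeff_psi k l
  simp only [coeff, Finset.sum_apply, Pi.smul_apply, smul_eq_mul, Finset.sum_mul, mul_assoc]
  rw [integral_finsetSum _ fun k _ => (integrable_mul_psi (D.psi_mem_F k) l).const_mul _]
  simp only [integral_const_mul, integral_psi_mul_psi, mul_ite, mul_one, mul_zero,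
    Finset.sum_ite_eq']

/-- The rectangular partial sum `∑_{k ≤ m} f̂(k) ψ_k` of the orthogonal expansion. -/
def rectSum (D : DigraphRep) (f : D.G → ℝ) (m : ℕ × ℕ) : D.G → ℝ :=
  ∑ k ∈ Finset.Iic m, D.coeff f k • D.psi k

lemma kernel_mul_kernel_eq_sum (m : ℕ × ℕ) (x y : D.G) :
    D.X₁.kernel m.1 x.1.1 y.1.1 * D.X₂.kernel m.2 x.1.2 y.1.2 =
      ∑ k ∈ Finset.Iic m, D.psi k y * D.psi k x := by
  rw [Filtration.kernel, Filtration.kernel, Finset.sum_apply, Finset.sum_apply,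
    Finset.sum_mul_sum, ← Finset.sum_product', Finset.Iic_product_Iic]
  refine Finset.sum_congr rfl fun k _ => ?_
  rw [psi_apply, psi_apply, Pi.smul_apply, Pi.smul_apply, smul_eq_mul, smul_eq_mul]
  ring

lemma rectSum_apply (hf : f ∈ D.F) (m : ℕ × ℕ) (x : D.G) :
    D.rectSum f m x =
      ∫ y, f y * (D.X₁.kernel m.1 x.1.1 y.1.1 * D.X₂.kernel m.2 x.1.2 y.1.2) ∂D.ν := by
  simp only [kernel_mul_kernel_eq_sum, Finset.mul_sum, ← mul_assoc]
  rw [integral_finsetSum _ fun k _ => (integrable_mul_psi hf k).mul_const _]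
  simp only [integral_mul_const, rectSum, Finset.sum_apply, Pi.smul_apply, smul_eq_mul, coeff]

lemma supNorm_rectSum_le (hf : f ∈ D.F) (m : ℕ × ℕ) :
    supNorm (D.rectSum f m) ≤ 9 * supNorm f := by
  refine iSup_le fun x => ?_
  have h_kernel := lintegral_enorm_mul_le (D.X₁.isDominated_kernel m.1 x.1.1)
    (D.X₂.isDominated_kernel m.2 x.1.2)
  calc ‖D.rectSum f m x‖ₑ
      ≤ ∫⁻ y, ‖f y * (D.X₁.kernel m.1 x.1.1 y.1.1 * D.X₂.kernel m.2 x.1.2 y.1.2)‖ₑ ∂D.ν := by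
        rw [rectSum_apply hf]
        exact enorm_integral_le_lintegral_enorm _
    _ ≤ ∫⁻ y, supNorm f * ‖D.X₁.kernel m.1 x.1.1 y.1.1 * D.X₂.kernel m.2 x.1.2 y.1.2‖ₑ ∂D.ν := by
        refine lintegral_mono fun y => ?_
        rw [enorm_mul]
        gcongr
        exact enorm_le_supNorm f y
    _ = supNorm f * ∫⁻ y, ‖D.X₁.kernel m.1 x.1.1 y.1.1 * D.X₂.kernel m.2 x.1.2 y.1.2‖ₑ ∂D.ν :=
        lintegral_const_mul' _ _ (supNorm_lt_top_of_mem_F hf).ne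
    _ ≤ supNorm f * ENNReal.ofReal (3 * 3) := by gcongr
    _ = 9 * supNorm f := by rw [mul_comm]; norm_num

end DigraphRep

/-! ### Multiplier operators -/

lemma eq_sum_Icc_diff {h : ℕ × ℕ → ℝ} {M : ℕ × ℕ} (hM : ∀ k ∉ Finset.Iic M, h k = 0)
    {k : ℕ × ℕ} (hk : k ≤ M) : h k = ∑ m ∈ Finset.Icc k M, diff₁ (diff₂ h) m := by
  have hM₁ (m₂ : ℕ) : h (M.1 + 1, m₂) = 0 := hM _ fun hm => by simpa using (Finset.mem_Iic.1 hm).1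
  have hM₂ (m₁ : ℕ) : h (m₁, M.2 + 1) = 0 := hM _ fun hm => by simpa using (Finset.mem_Iic.1 hm).2
  have sum_diff₁_diff₂ (m₂ : ℕ) :
      ∑ m₁ ∈ Finset.Icc k.1 M.1, diff₁ (diff₂ h) (m₁, m₂) = -diff₂ h (k.1, m₂) := by
    rw [← Finset.Ico_add_one_right_eq_Icc]
    refine (Finset.sum_Ico_sub (fun m₁ => diff₂ h (m₁, m₂)) (hk.1.trans (Nat.le_succ _))).trans ?_
    simp only [diff₂, hM₁, sub_zero, zero_sub]
  have sum_diff₂ : ∑ m₂ ∈ Finset.Icc k.2 M.2, diff₂ h (k.1, m₂) = -h k := by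
    rw [← Finset.Ico_add_one_right_eq_Icc]
    refine (Finset.sum_Ico_sub (fun m₂ => h (k.1, m₂)) (hk.2.trans (Nat.le_succ _))).trans ?_
    rw [hM₂, zero_sub]
  rw [← Finset.Icc_product_Icc, Finset.sum_product_right]
  simp only [sum_diff₁_diff₂, Finset.sum_neg_distrib, sum_diff₂, neg_neg]

lemma sum_smul_eq_sum_diff_smul {V : Type*} [AddCommGroup V] [Module ℝ V] {h : ℕ × ℕ → ℝ}
    {M : ℕ × ℕ} (hM : ∀ k ∉ Finset.Iic M, h k = 0) (a : ℕ × ℕ → V) :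
    ∑ k ∈ Finset.Iic M, h k • a k =
      ∑ m ∈ Finset.Iic M, diff₁ (diff₂ h) m • ∑ k ∈ Finset.Iic m, a k := by
  calc ∑ k ∈ Finset.Iic M, h k • a k
      = ∑ k ∈ Finset.Iic M, ∑ m ∈ Finset.Icc k M, diff₁ (diff₂ h) m • a k :=
        Finset.sum_congr rfl fun k hk => by
          rw [eq_sum_Icc_diff hM (Finset.mem_Iic.1 hk), Finset.sum_smul]
    _ = ∑ m ∈ Finset.Iic M, ∑ k ∈ Finset.Iic m, diff₁ (diff₂ h) m • a k := by
        refine Finset.sum_comm' fun k m => ?_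
        simp only [Finset.mem_Iic, Finset.mem_Icc]
        exact ⟨fun h => ⟨h.2.1, h.2.2⟩, fun h => ⟨h.1.trans h.2, h⟩⟩
    _ = ∑ m ∈ Finset.Iic M, diff₁ (diff₂ h) m • ∑ k ∈ Finset.Iic m, a k := by
        simp only [Finset.smul_sum]

lemma exists_forall_notMem_Iic_eq_zero {h : ℕ × ℕ → ℝ} (hh : (Function.support h).Finite) :
    ∃ M, ∀ k ∉ Finset.Iic M, h k = 0 := by
  obtain ⟨M, hM⟩ := hh.bddAbove
  exact ⟨M, fun k hk => by_contra fun h_ne => hk (Finset.mem_Iic.2 (hM h_ne))⟩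

namespace DigraphRep

variable {D : DigraphRep} {h h' : ℕ × ℕ → ℝ} {f f' : D.G → ℝ}

/-- The multiplier operator with symbol `h`, for symbols with finite support. -/
def mult (D : DigraphRep) (h : ℕ × ℕ → ℝ) (f : D.G → ℝ) : D.G → ℝ :=
  ∑ᶠ k, (h k * D.coeff f k) • D.psi k

lemma mult_eq_sum {s : Finset (ℕ × ℕ)} (hs : ∀ k ∉ s, h k = 0) (f : D.G → ℝ) :
    D.mult h f = ∑ k ∈ s, (h k * D.coeff f k) • D.psi k := by
  refine finsum_eq_sum_of_support_subset _ fun k hk => ?_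
  by_contra hks
  exact hk (by simp only [hs k hks, zero_mul, zero_smul])

lemma mult_eq_sum_toFinset (hh : (Function.support h).Finite) (f : D.G → ℝ) :
    D.mult h f = ∑ k ∈ hh.toFinset, (h k * D.coeff f k) • D.psi k :=
  mult_eq_sum (fun k hk => by simpa using hk) f

lemma mult_congr (e : ∀ k, h k * D.coeff f k = h' k * D.coeff f' k) :
    D.mult h f = D.mult h' f' := by
  simp only [mult, e]

lemma coeff_mult (hh : (Function.support h).Finite) (f : D.G → ℝ) (k : ℕ × ℕ) :
    D.coeff (D.mult h f) k = h k * D.coeff f k := by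
  rw [mult_eq_sum_toFinset hh, coeff_sum_smul_psi, ite_eq_left_iff, hh.mem_toFinset]
  intro hk
  rw [Function.notMem_support.1 hk, zero_mul]

lemma mult_mem_span (hh : (Function.support h).Finite) (f : D.G → ℝ) {S : Set (ℕ × ℕ)}
    (hS : Function.support h ⊆ S) : D.mult h f ∈ Submodule.span ℝ (D.psi '' S) := by
  rw [mult_eq_sum_toFinset hh]
  exact Submodule.sum_mem _ fun k hk => Submodule.smul_mem _ _
    (Submodule.subset_span ⟨k, hS (hh.mem_toFinset.1 hk), rfl⟩)

lemma mult_mem_F (hh : (Function.support h).Finite) (f : D.G → ℝ) : D.mult h f ∈ D.F :=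
  mem_F_of_mem_span (mult_mem_span hh f (D.Omega_eq_univ ▸ Set.subset_univ _))

lemma mult_sum_left {ι : Type*} (s : Finset ι) {h : ι → ℕ × ℕ → ℝ}
    (hh : ∀ i ∈ s, (Function.support (h i)).Finite) (f : D.G → ℝ) :
    D.mult (∑ i ∈ s, h i) f = ∑ i ∈ s, D.mult (h i) f := by
  simp only [mult, Finset.sum_apply, Finset.sum_mul, Finset.sum_smul]
  refine finsum_sum_comm s _ fun i hi => (hh i hi).subset fun k hk hk_zero => hk ?_
  simp only [hk_zero, zero_mul, zero_smul]

lemma mult_mult (hh' : (Function.support h').Finite) (f : D.G → ℝ) :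
    D.mult h (D.mult h' f) = D.mult (h * h') f :=
  mult_congr fun k => by rw [coeff_mult hh', Pi.mul_apply, mul_assoc]

lemma mult_sub_right (hh : (Function.support h).Finite) (hf : f ∈ D.F) (hf' : f' ∈ D.F) :
    D.mult h (f - f') = D.mult h f - D.mult h f' := by
  simp only [mult_eq_sum_toFinset hh, ← Finset.sum_sub_distrib, coeff_sub hf hf', mul_sub, sub_smul]

lemma mult_eq_sum_diff_smul_rectSum {M : ℕ × ℕ} (hM : ∀ k ∉ Finset.Iic M, h k = 0)
    (f : D.G → ℝ) :
    D.mult h f = ∑ m ∈ Finset.Iic M, diff₁ (diff₂ h) m • D.rectSum f m := by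
  simp only [mult_eq_sum hM, mul_smul, rectSum, sum_smul_eq_sum_diff_smul hM]

lemma supNorm_mult_le_sum {M : ℕ × ℕ} (hM : ∀ k ∉ Finset.Iic M, h k = 0) (hf : f ∈ D.F) :
    supNorm (D.mult h f) ≤
      9 * (∑ m ∈ Finset.Iic M, ‖diff₁ (diff₂ h) m‖ₑ) * supNorm f :=
  calc supNorm (D.mult h f)
      ≤ ∑ m ∈ Finset.Iic M, ‖diff₁ (diff₂ h) m‖ₑ * (9 * supNorm f) := by
        rw [mult_eq_sum_diff_smul_rectSum hM]
        refine (supNorm_sum_le _ _).trans (Finset.sum_le_sum fun m _ => ?_)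
        rw [supNorm_smul]
        gcongr
        exact supNorm_rectSum_le hf m
    _ = 9 * (∑ m ∈ Finset.Iic M, ‖diff₁ (diff₂ h) m‖ₑ) * supNorm f := by
        rw [← Finset.sum_mul]
        ring

lemma supNorm_mult_le (hh : (Function.support h).Finite) (hf : f ∈ D.F) :
    supNorm (D.mult h f) ≤ 9 * variation h * supNorm f := by
  obtain ⟨M, hM⟩ := exists_forall_notMem_Iic_eq_zero hh
  refine (supNorm_mult_le_sum hM hf).trans ?_
  gcongr
  exact (ENNReal.sum_le_tsum _).trans le_add_self

lemma exists_supNorm_mult_le (D : DigraphRep) (hh : (Function.support h).Finite) :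
    ∃ C : ℝ≥0, ∀ f ∈ D.F, supNorm (D.mult h f) ≤ C * supNorm f := by
  obtain ⟨M, hM⟩ := exists_forall_notMem_Iic_eq_zero hh
  refine ⟨9 * ∑ m ∈ Finset.Iic M, ‖diff₁ (diff₂ h) m‖₊, fun f hf => ?_⟩
  push_cast
  exact supNorm_mult_le_sum hM hf

end DigraphRep

/-! ### Discrete Hardy inequalities -/

lemma seqNorm_eq_eLpNorm {ρ : ℝ≥0∞} (hρ : 0 < ρ) (γ : ℝ) (a : ℕ → ℝ≥0∞) :
    seqNorm ρ γ a = eLpNorm (fun n : ℕ => (2 : ℝ≥0∞) ^ (n * γ) * a n) ρ Measure.count := by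
  rcases eq_or_ne ρ ∞ with rfl | hρ_top
  · simp only [seqNorm, if_true, eLpNorm_exponent_top, eLpNormEssSup_count, enorm_eq_self]
  · simp only [seqNorm, if_neg hρ_top, eLpNorm_eq_lintegral_rpow_enorm_toReal hρ.ne' hρ_top,
      lintegral_count, enorm_eq_self, ENNReal.mul_rpow_of_nonneg _ _ ENNReal.toReal_nonneg,
      ENNReal.rpow_mul]

lemma mem_seqSpace_iff_memLp {ρ : ℝ≥0∞} (hρ : 0 < ρ) {γ : ℝ} {a : ℕ → ℝ≥0∞} :
    a ∈ seqSpace ρ γ ↔ MemLp (fun n : ℕ => (2 : ℝ≥0∞) ^ (n * γ) * a n) ρ Measure.count := by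
  rw [seqSpace, Set.mem_ofPred_eq, seqNorm_eq_eLpNorm hρ]
  exact ⟨fun h => ⟨Measurable.of_discrete.aestronglyMeasurable, h⟩, fun h => h.2⟩

lemma memLp_count_of_memLp_shift {ρ : ℝ≥0∞} (hρ : 0 < ρ) {A : ℕ → ℝ≥0∞} (m : ℕ)
    (hA : ∀ n, A n < ∞) (h : MemLp (fun n => A (n + m)) ρ Measure.count) :
    MemLp A ρ Measure.count := by
  refine ⟨Measurable.of_discrete.aestronglyMeasurable, ?_⟩
  have h_tail := h.2
  rcases eq_or_ne ρ ∞ with rfl | hρ_top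
  · simp only [eLpNorm_exponent_top, eLpNormEssSup_count, enorm_eq_self] at h_tail ⊢
    have h_head : ∑ n ∈ Finset.range m, A n < ∞ := ENNReal.sum_lt_top.2 fun n _ => hA n
    refine (iSup_le fun n => ?_).trans_lt (ENNReal.add_lt_top.2 ⟨h_head, h_tail⟩)
    rcases lt_or_ge n m with hn | hn
    · exact (Finset.single_le_sum_of_canonicallyOrdered (Finset.mem_range.2 hn)).trans le_self_add
    · obtain ⟨i, rfl⟩ := Nat.exists_eq_add_of_le' hn
      exact (le_iSup (fun i => A (i + m)) i).trans le_add_self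
  · rw [eLpNorm_lt_top_iff_lintegral_rpow_enorm_lt_top hρ.ne' hρ_top, lintegral_count] at h_tail ⊢
    rw [← Summable.sum_add_tsum_nat_add' (k := m) ENNReal.summable]
    exact ENNReal.add_lt_top.2 ⟨ENNReal.sum_lt_top.2 fun n _ =>
      ENNReal.rpow_lt_top_of_nonneg ENNReal.toReal_nonneg (hA n).ne, h_tail⟩

lemma tsum_pow_lt_top {q : ℝ≥0∞} (hq : q < 1) : ∑' n : ℕ, q ^ n < ∞ := by
  rw [ENNReal.tsum_geometric]
  exact ENNReal.inv_lt_top.2 (tsub_pos_of_lt hq)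

lemma tsum_pow_dist_le (q : ℝ≥0∞) (n : ℕ) : ∑' j, q ^ n.dist j ≤ 2 * ∑' i : ℕ, q ^ i := by
  rw [← Summable.sum_add_tsum_nat_add' (k := n) ENNReal.summable, two_mul]
  refine add_le_add ?_ (ENNReal.tsum_le_tsum fun i => le_of_eq ?_)
  · calc ∑ j ∈ Finset.range n, q ^ n.dist j
        = ∑ i ∈ Finset.range n, q ^ (i + 1) := by
          rw [← Finset.sum_range_reflect]
          refine Finset.sum_congr rfl fun i hi => ?_
          have hi_lt := Finset.mem_range.1 hi
          rw [Nat.dist_eq_sub_of_le_right (by lia)]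
          congr 1
          lia
      _ ≤ ∑' i : ℕ, q ^ (i + 1) := ENNReal.sum_le_tsum _
      _ ≤ ∑' i : ℕ, q ^ i :=
          ENNReal.tsum_comp_le_tsum_of_injective (add_left_injective 1) fun i => q ^ i
  · rw [Nat.dist_eq_sub_of_le (Nat.le_add_left n i), Nat.add_sub_cancel]

section Hardy

variable {ρ q : ℝ≥0∞} {A B : ℕ → ℝ≥0∞}

lemma tsum_pow_dist_mul_le_iSup (q : ℝ≥0∞) (B : ℕ → ℝ≥0∞) (n : ℕ) :
    ∑' j, (q * q) ^ n.dist j * B j ≤ 2 * (∑' i : ℕ, q ^ i) * ⨆ j, q ^ n.dist j * B j :=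
  calc ∑' j, (q * q) ^ n.dist j * B j
      ≤ ∑' j, q ^ n.dist j * ⨆ j, q ^ n.dist j * B j := by
        refine ENNReal.tsum_le_tsum fun j => ?_
        rw [mul_pow, mul_assoc]
        gcongr
        exact le_iSup (fun j => q ^ n.dist j * B j) j
    _ = (∑' j, q ^ n.dist j) * ⨆ j, q ^ n.dist j * B j := ENNReal.tsum_mul_right
    _ ≤ 2 * (∑' i : ℕ, q ^ i) * ⨆ j, q ^ n.dist j * B j := by
        gcongr
        exact tsum_pow_dist_le q n

lemma tsum_tsum_pow_dist_mul_lt_top (hq : q < 1) (hB : ∑' j, B j < ∞) :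
    ∑' n : ℕ, ∑' j, q ^ n.dist j * B j < ∞ :=
  calc ∑' n : ℕ, ∑' j, q ^ n.dist j * B j
      = ∑' j : ℕ, (∑' n, q ^ j.dist n) * B j := by
        rw [ENNReal.tsum_comm]
        simp only [ENNReal.tsum_mul_right, Nat.dist_comm]
    _ ≤ ∑' j, 2 * (∑' i : ℕ, q ^ i) * B j := by
        gcongr with j
        exact tsum_pow_dist_le q j
    _ = 2 * (∑' i : ℕ, q ^ i) * ∑' j, B j := ENNReal.tsum_mul_left
    _ < ∞ := ENNReal.mul_lt_top (ENNReal.mul_lt_top ENNReal.ofNat_lt_top (tsum_pow_lt_top hq)) hB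

lemma memLp_iSup_pow_dist_mul (hρ : 0 < ρ) (hq : q < 1) (hB : MemLp B ρ Measure.count) :
    MemLp (fun n : ℕ => ⨆ j, q ^ n.dist j * B j) ρ Measure.count := by
  refine ⟨Measurable.of_discrete.aestronglyMeasurable, ?_⟩
  have hB_lt := hB.2
  rcases eq_or_ne ρ ∞ with rfl | hρ_top
  · simp only [eLpNorm_exponent_top, eLpNormEssSup_count, enorm_eq_self] at hB_lt ⊢
    refine (iSup_le fun n => ?_).trans_lt hB_lt
    exact iSup_mono fun j => mul_le_of_le_one_left' (pow_le_one' hq.le _)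
  rw [eLpNorm_lt_top_iff_lintegral_rpow_enorm_lt_top hρ.ne' hρ_top, lintegral_count] at hB_lt ⊢
  have hp : 0 < ρ.toReal := ENNReal.toReal_pos hρ.ne' hρ_top
  refine (ENNReal.tsum_le_tsum fun n => ?_).trans_lt
    (tsum_tsum_pow_dist_mul_lt_top (ENNReal.rpow_lt_one hq hp) hB_lt)
  calc (⨆ j, q ^ n.dist j * B j) ^ ρ.toReal
      = ⨆ j, (q ^ n.dist j * B j) ^ ρ.toReal := (ENNReal.orderIsoRpow _ hp).map_iSup _
    _ ≤ ∑' j, (q ^ ρ.toReal) ^ n.dist j * B j ^ ρ.toReal := by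
        refine iSup_le fun j => ?_
        rw [ENNReal.mul_rpow_of_nonneg _ _ hp.le, ← ENNReal.rpow_natCast_mul,
          mul_comm (n.dist j : ℝ), ENNReal.rpow_mul_natCast]
        exact ENNReal.le_tsum (f := fun j => (q ^ ρ.toReal) ^ n.dist j * B j ^ ρ.toReal) j

/-- Splitting `q = s * s` leaves a summable factor `s ^ |n - j|` after `s ^ |n - j| * B j` has been
estimated by its supremum, which avoids Hölder's inequality and with it a case distinction at
`ρ = 1`. -/
lemma memLp_of_le_tsum_pow_dist_mul (hρ : 0 < ρ) (hq : q < 1) {C : ℝ≥0}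
    (hB : MemLp B ρ Measure.count) (h : ∀ n, A n ≤ C * ∑' j, q ^ n.dist j * B j) :
    MemLp A ρ Measure.count := by
  obtain ⟨s, hs, rfl⟩ : ∃ s < 1, s * s = q := by
    refine ⟨q ^ (2⁻¹ : ℝ), ENNReal.rpow_lt_one hq (by norm_num), ?_⟩
    rw [← ENNReal.rpow_add_of_nonneg _ _ (by norm_num) (by norm_num)]
    norm_num
  lift ∑' i : ℕ, s ^ i to ℝ≥0 using (tsum_pow_lt_top hs).ne with S hS
  refine (memLp_iSup_pow_dist_mul hρ hs hB).of_enorm_le_mul (c := C * (2 * S))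
    Measurable.of_discrete.aestronglyMeasurable (ae_of_all _ fun n => (h n).trans ?_)
  push_cast
  rw [mul_assoc, hS, enorm_eq_self]
  gcongr
  exact tsum_pow_dist_mul_le_iSup s B n

end Hardy

section SeqSpace

variable {ρ : ℝ≥0∞} {γ : ℝ} {C : ℝ≥0} {a b : ℕ → ℝ≥0∞}

lemma two_rpow_add (s t : ℝ) : (2 : ℝ≥0∞) ^ (s + t) = 2 ^ s * 2 ^ t :=
  ENNReal.rpow_add _ _ two_ne_zero ENNReal.ofNat_ne_top

lemma two_rpow_lt_one {t : ℝ} (ht : t < 0) : (2 : ℝ≥0∞) ^ t < 1 :=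
  ENNReal.rpow_lt_one_of_one_lt_of_neg ENNReal.one_lt_two ht

lemma two_pow_mul (n r : ℕ) : (2 : ℝ≥0∞) ^ (n * r) = 2 ^ ((n : ℝ) * r) := by
  rw [← Nat.cast_mul, ENNReal.rpow_natCast]

lemma mem_seqSpace_of_le_tsum_add (hρ : 0 < ρ) (hγ : 0 < γ) (hb : b ∈ seqSpace ρ γ)
    (h : ∀ n, a n ≤ C * ∑' i, b (n + i)) : a ∈ seqSpace ρ γ := by
  rw [mem_seqSpace_iff_memLp hρ] at hb ⊢
  refine memLp_of_le_tsum_pow_dist_mul hρ (two_rpow_lt_one (neg_lt_zero.2 hγ)) (C := C) hb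
    fun n => ?_
  have weight_eq (i : ℕ) : (2 : ℝ≥0∞) ^ (n * γ) =
      (2 ^ (-γ)) ^ n.dist (n + i) * 2 ^ ((n + i : ℕ) * γ) := by
    rw [Nat.dist_eq_sub_of_le (Nat.le_add_right n i), Nat.add_sub_cancel_left,
      ← ENNReal.rpow_mul_natCast, ← two_rpow_add]
    congr 1
    push_cast
    ring
  calc (2 : ℝ≥0∞) ^ (n * γ) * a n
      ≤ 2 ^ (n * γ) * (C * ∑' i, b (n + i)) := by gcongr; exact h n
    _ = C * ∑' i, 2 ^ (n * γ) * b (n + i) := by rw [ENNReal.tsum_mul_left, mul_left_comm]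
    _ = C * ∑' i, (2 ^ (-γ)) ^ n.dist (n + i) * (2 ^ ((n + i : ℕ) * γ) * b (n + i)) := by
        congr 1
        exact tsum_congr fun i => by rw [weight_eq, mul_assoc]
    _ ≤ C * ∑' j, (2 ^ (-γ)) ^ n.dist j * (2 ^ (j * γ) * b j) :=
        mul_le_mul_right (ENNReal.tsum_comp_le_tsum_of_injective (add_right_injective n)
          fun j : ℕ => (2 ^ (-γ)) ^ n.dist j * (2 ^ (j * γ) * b j)) _

lemma mem_seqSpace_of_le_sum_range (hρ : 0 < ρ) {r : ℕ} (hγr : γ < r) (hb : b ∈ seqSpace ρ γ)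
    (h : ∀ n, 2 ^ (n * r) * a n ≤ C * ∑ j ∈ Finset.range (n + 1), 2 ^ (j * r) * b j) :
    a ∈ seqSpace ρ γ := by
  rw [mem_seqSpace_iff_memLp hρ] at hb ⊢
  refine memLp_of_le_tsum_pow_dist_mul hρ (two_rpow_lt_one (sub_neg.2 hγr)) (C := C) hb
    fun n => ?_
  have weight_eq {j : ℕ} (hj : j ∈ Finset.range (n + 1)) :
      (2 : ℝ≥0∞) ^ (n * (γ - r)) * 2 ^ (j * r) = (2 ^ (γ - r)) ^ n.dist j * 2 ^ (j * γ) := by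
    have hjn : j ≤ n := Finset.mem_range_succ_iff.1 hj
    rw [Nat.dist_eq_sub_of_le_right hjn, two_pow_mul, ← ENNReal.rpow_mul_natCast, ← two_rpow_add,
      ← two_rpow_add, Nat.cast_sub hjn]
    congr 1
    ring
  calc (2 : ℝ≥0∞) ^ (n * γ) * a n
      = 2 ^ (n * (γ - r)) * (2 ^ (n * r) * a n) := by
        rw [two_pow_mul, ← mul_assoc, ← two_rpow_add, mul_sub, sub_add_cancel]
    _ ≤ 2 ^ (n * (γ - r)) * (C * ∑ j ∈ Finset.range (n + 1), 2 ^ (j * r) * b j) :=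
        mul_le_mul_right (h n) _
    _ = C * ∑ j ∈ Finset.range (n + 1), 2 ^ (n * (γ - r)) * 2 ^ (j * r) * b j := by
        simp only [mul_assoc, ← Finset.mul_sum]
        rw [mul_left_comm]
    _ = C * ∑ j ∈ Finset.range (n + 1), (2 ^ (γ - r)) ^ n.dist j * (2 ^ (j * γ) * b j) := by
        congr 1
        exact Finset.sum_congr rfl fun j hj => by rw [weight_eq hj, mul_assoc]
    _ ≤ C * ∑' j, (2 ^ (γ - r)) ^ n.dist j * (2 ^ (j * γ) * b j) := by
        gcongr
        exact ENNReal.sum_le_tsum _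

lemma mem_seqSpace_of_le (hρ : 0 < ρ) (hb : b ∈ seqSpace ρ γ) (h : ∀ n, a n ≤ C * b n) :
    a ∈ seqSpace ρ γ := by
  rw [mem_seqSpace_iff_memLp hρ] at hb ⊢
  refine hb.of_enorm_le_mul (c := C) Measurable.of_discrete.aestronglyMeasurable
    (ae_of_all _ fun n => ?_)
  rw [enorm_eq_self, enorm_eq_self, mul_left_comm]
  gcongr
  exact h n

lemma mem_seqSpace_of_shift_le (hρ : 0 < ρ) (m : ℕ) (ha : ∀ n, a n < ∞) (hb : b ∈ seqSpace ρ γ)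
    (h : ∀ n, a (n + m) ≤ C * b n) : a ∈ seqSpace ρ γ := by
  have two_rpow_lt_top (t : ℝ) : (2 : ℝ≥0∞) ^ t < ∞ :=
    (ENNReal.rpow_ne_top_of_ne_zero two_ne_zero ENNReal.ofNat_ne_top).lt_top
  rw [mem_seqSpace_iff_memLp hρ] at hb ⊢
  refine memLp_count_of_memLp_shift hρ m (fun n => ENNReal.mul_lt_top (two_rpow_lt_top _) (ha n)) ?_
  lift (2 : ℝ≥0∞) ^ (m * γ) to ℝ≥0 using (two_rpow_lt_top _).ne with c hc
  refine hb.of_enorm_le_mul (c := c * C) Measurable.of_discrete.aestronglyMeasurable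
    (ae_of_all _ fun n => ?_)
  rw [enorm_eq_self, enorm_eq_self]
  calc (2 : ℝ≥0∞) ^ ((n + m : ℕ) * γ) * a (n + m)
      ≤ 2 ^ ((n + m : ℕ) * γ) * (C * b n) := by gcongr; exact h n
    _ = ↑(c * C) * (2 ^ (n * γ) * b n) := by
        rw [Nat.cast_add, add_mul, two_rpow_add, ← hc]
        push_cast
        ring

lemma add_mem_seqSpace (hρ : 0 < ρ) (ha : a ∈ seqSpace ρ γ) (hb : b ∈ seqSpace ρ γ) :
    a + b ∈ seqSpace ρ γ := by
  rw [mem_seqSpace_iff_memLp hρ] at ha hb ⊢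
  simp only [Pi.add_apply, mul_add]
  exact ha.add hb

end SeqSpace

/-! ### Reconstruction operators -/

section PartialSum

variable {Ω : Set (ℕ × ℕ)} {g : ℕ → ℕ × ℕ → ℝ}

lemma partialSum_eq_sum (g : ℕ → ℕ × ℕ → ℝ) (n : ℕ) :
    partialSum g n = ∑ j ∈ Finset.range (n + 1), g j :=
  funext fun _ => (Finset.sum_apply _ _ _).symm

namespace IsAdmissible

lemma partialSum_nonneg (hg : IsAdmissible Ω g) (n : ℕ) (k : ℕ × ℕ) : 0 ≤ partialSum g n k :=
  Finset.sum_nonneg fun j _ => (hg.mem_Icc j k).1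

lemma monotone_partialSum (hg : IsAdmissible Ω g) (k : ℕ × ℕ) :
    Monotone fun n => partialSum g n k := fun _ _ hmn =>
  Finset.sum_le_sum_of_subset_of_nonneg (Finset.range_mono (Nat.succ_le_succ hmn))
    fun j _ _ => (hg.mem_Icc j k).1

lemma finite_support_partialSum (hg : IsAdmissible Ω g) (n : ℕ) :
    (Function.support (partialSum g n)).Finite := by
  refine ((Finset.range (n + 1)).finite_toSet.biUnion fun j _ => hg.finite_support j).subset
    fun k hk => ?_
  obtain ⟨j, hj, hgj⟩ := Finset.exists_ne_zero_of_sum_ne_zero hk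
  exact Set.mem_biUnion (Finset.mem_coe.2 hj) hgj

lemma exists_partialSum_pos (hg : IsAdmissible Ω g) {k : ℕ × ℕ} (hk : k ∈ Ω) :
    ∃ n, 0 < partialSum g n k := by
  obtain ⟨j, hj⟩ : ∃ j, g j k ≠ 0 := by
    by_contra! h_zero
    have h_sum := hg.hasSum k hk
    simp only [h_zero] at h_sum
    exact zero_ne_one (hasSum_zero.unique h_sum)
  exact ⟨j, ((hg.mem_Icc j k).1.lt_of_ne' hj).trans_le (Finset.single_le_sum
    (f := fun j => g j k) (fun i _ => (hg.mem_Icc i k).1) (Finset.self_mem_range_succ j))⟩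

lemma partialSum_eq_one (hg : IsAdmissible Ω g) {m : ℕ}
    (hm : ∀ j j', j + m < j' → ∀ k, g j k * g j' k = 0) {n N : ℕ} (hN : n + m ≤ N) {k : ℕ × ℕ}
    (hk : k ∈ Ω) (h : 0 < partialSum g n k) : partialSum g N k = 1 := by
  obtain ⟨j, hj, hgj⟩ := Finset.exists_ne_zero_of_sum_ne_zero h.ne'
  refine (hasSum_sum_of_ne_finset_zero fun j' hj' => ?_).unique (hg.hasSum k hk)
  rw [Finset.mem_range] at hj hj'
  exact (mul_eq_zero.1 (hm j j' (by lia) k)).resolve_left hgj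

end IsAdmissible

end PartialSum

namespace DigraphRep

variable {D : DigraphRep} {g : ℕ → ℕ × ℕ → ℝ} {C : ℝ≥0} {f P : D.G → ℝ} {m n N : ℕ}

lemma sigma_eq_mult (D : DigraphRep) (g : ℕ → ℕ × ℕ → ℝ) (n : ℕ) (f : D.G → ℝ) :
    D.sigma g n f = D.mult (partialSum g n) f := by
  simp only [sigma, mult, D.Omega_eq_univ, Set.mem_univ, finsum_true]

lemma sigma_eq_sum_mult (hg : IsAdmissible D.Omega g) (n : ℕ) (f : D.G → ℝ) :
    D.sigma g n f = ∑ j ∈ Finset.range (n + 1), D.mult (g j) f := by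
  rw [sigma_eq_mult, partialSum_eq_sum, mult_sum_left _ fun j _ => hg.finite_support j]

lemma tau_eq_mult (hg : IsAdmissible D.Omega g) (j : ℕ) (f : D.G → ℝ) :
    D.tau g j f = D.mult (g j) f := by
  cases j with
  | zero => rw [tau, sigma_eq_sum_mult hg, Finset.sum_range_one]
  | succ j =>
    rw [tau, sigma_eq_sum_mult hg, sigma_eq_sum_mult hg, Finset.sum_range_succ _ (j + 1),
      add_sub_cancel_left]

lemma sigma_mem_F (hg : IsAdmissible D.Omega g) (n : ℕ) (f : D.G → ℝ) : D.sigma g n f ∈ D.F :=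
  D.sigma_eq_mult g n f ▸ mult_mem_F (hg.finite_support_partialSum n) f

lemma tau_mem_F (hg : IsAdmissible D.Omega g) (j : ℕ) (f : D.G → ℝ) : D.tau g j f ∈ D.F :=
  tau_eq_mult hg j f ▸ mult_mem_F (hg.finite_support j) f

lemma sigma_mem_polys (hg : IsAdmissible D.Omega g) (n : ℕ) (f : D.G → ℝ) :
    D.sigma g n f ∈ D.polys g n := by
  rw [sigma_eq_mult]
  exact mult_mem_span (hg.finite_support_partialSum n) f fun k hk =>
    ⟨D.Omega_eq_univ ▸ Set.mem_univ k, (hg.partialSum_nonneg n k).lt_of_ne' hk⟩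

lemma sigma_sub (hg : IsAdmissible D.Omega g) (n : ℕ) (hf : f ∈ D.F) (hP : P ∈ D.F) :
    D.sigma g n (f - P) = D.sigma g n f - D.sigma g n P := by
  simp only [sigma_eq_mult, mult_sub_right (hg.finite_support_partialSum n) hf hP]

lemma exists_forall_supNorm_sigma_le (hg : IsAdmissible D.Omega g)
    (hH : ∃ C : ℝ≥0, ∀ n ≥ 1, variation (partialSum g n) ≤ C) :
    ∃ C : ℝ≥0, ∀ n, ∀ f ∈ D.F, supNorm (D.sigma g n f) ≤ C * supNorm f := by
  obtain ⟨V, hV⟩ := hH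
  obtain ⟨C₀, hC₀⟩ := D.exists_supNorm_mult_le (hg.finite_support_partialSum 0)
  refine ⟨C₀ + 9 * V, fun n f hf => ?_⟩
  rw [sigma_eq_mult]
  push_cast
  rcases Nat.eq_zero_or_pos n with rfl | hn
  · refine (hC₀ f hf).trans ?_
    gcongr
    exact le_self_add
  · refine (supNorm_mult_le (hg.finite_support_partialSum n) hf).trans ?_
    gcongr
    exact (mul_le_mul_right (hV n hn) 9).trans le_add_self

lemma mult_eq_self {h : ℕ × ℕ → ℝ} (hh : (Function.support h).Finite) {S : Set (ℕ × ℕ)}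
    (hS : ∀ k ∈ S, h k = 1) (hP : P ∈ Submodule.span ℝ (D.psi '' S)) : D.mult h P = P := by
  obtain ⟨c, hcS, rfl⟩ := (Finsupp.mem_span_image_iff_linearCombination ℝ).1 hP
  have hc {k : ℕ × ℕ} (hk : k ∈ c.support) : h k = 1 := hS k (hcS hk)
  have hc_subset : c.support ⊆ hh.toFinset := fun k hk => hh.mem_toFinset.2 (by simp [hc hk])
  rw [Finsupp.linearCombination_apply, Finsupp.sum, mult_eq_sum_toFinset hh]
  simp only [coeff_sum_smul_psi, mul_ite, mul_zero, ite_smul, zero_smul, Finset.sum_ite_mem,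
    Finset.inter_eq_right.2 hc_subset]
  exact Finset.sum_congr rfl fun k hk => by rw [hc hk, one_mul]

lemma mem_F_of_mem_polys (hP : P ∈ D.polys g n) : P ∈ D.F :=
  mem_F_of_mem_span (Submodule.span_mono (Set.image_mono fun _ hk => hk.1) hP)

lemma monotone_polys (hg : IsAdmissible D.Omega g) : Monotone (D.polys g) := fun _ _ hmn =>
  Submodule.span_mono (Set.image_mono fun k hk =>
    ⟨hk.1, hk.2.trans_le (hg.monotone_partialSum k hmn)⟩)

lemma exists_mem_polys (hg : IsAdmissible D.Omega g)
    (hP : P ∈ Submodule.span ℝ (D.psi '' D.Omega)) : ∃ n, P ∈ D.polys g n := by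
  rw [← Submodule.mem_iSup_of_directed _ (monotone_polys hg).directed_le]
  refine Submodule.span_le.2 ?_ hP
  rintro _ ⟨k, hk, rfl⟩
  obtain ⟨n, hn⟩ := hg.exists_partialSum_pos hk
  exact Submodule.mem_iSup_of_mem n (Submodule.subset_span ⟨k, ⟨hk, hn⟩, rfl⟩)

lemma sigma_eq_self (hg : IsAdmissible D.Omega g)
    (hm : ∀ j j', j + m < j' → ∀ k, g j k * g j' k = 0) (hN : n + m ≤ N) (hP : P ∈ D.polys g n) :
    D.sigma g N P = P := by
  rw [sigma_eq_mult]
  exact mult_eq_self (hg.finite_support_partialSum N)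
    (fun k hk => hg.partialSum_eq_one hm hN hk.1 hk.2) hP

lemma degApprox_le_of_mem (hP : P ∈ D.polys g n) (f : D.G → ℝ) :
    D.degApprox g n f ≤ supNorm (f - P) := iInf₂_le P hP

lemma supNorm_sub_sigma_le (hg : IsAdmissible D.Omega g)
    (hm : ∀ j j', j + m < j' → ∀ k, g j k * g j' k = 0)
    (hC : ∀ n, ∀ f ∈ D.F, supNorm (D.sigma g n f) ≤ C * supNorm f) (hf : f ∈ D.F)
    (hN : n + m ≤ N) (hP : P ∈ D.polys g n) :
    supNorm (f - D.sigma g N f) ≤ (1 + C) * supNorm (f - P) := by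
  have hPF := mem_F_of_mem_polys hP
  calc supNorm (f - D.sigma g N f) = supNorm ((f - P) - D.sigma g N (f - P)) := by
        rw [sigma_sub hg N hf hPF, sigma_eq_self hg hm hN hP, sub_sub_sub_cancel_right]
    _ ≤ supNorm (f - P) + supNorm (D.sigma g N (f - P)) := supNorm_sub_le _ _
    _ ≤ supNorm (f - P) + C * supNorm (f - P) := by
        gcongr
        exact hC N _ (sub_mem_F hf hPF)
    _ = (1 + C) * supNorm (f - P) := by ring

lemma supNorm_sub_sigma_le_degApprox (hg : IsAdmissible D.Omega g)
    (hm : ∀ j j', j + m < j' → ∀ k, g j k * g j' k = 0)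
    (hC : ∀ n, ∀ f ∈ D.F, supNorm (D.sigma g n f) ≤ C * supNorm f) (hf : f ∈ D.F) (n : ℕ) :
    supNorm (f - D.sigma g (n + m) f) ≤ (1 + C) * D.degApprox g n f := by
  simp only [degApprox, ENNReal.mul_iInf_of_ne (a := 1 + C) (by simp) (by finiteness)]
  exact le_iInf₂ fun P hP => supNorm_sub_sigma_le hg hm hC hf le_rfl hP

lemma exists_supNorm_sub_sigma_le (hg : IsAdmissible D.Omega g)
    (hC : ∀ n, ∀ f ∈ D.F, supNorm (D.sigma g n f) ≤ C * supNorm f) (hf : f ∈ D.F)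
    {ε : ℝ≥0∞} (hε : 0 < ε) : ∃ N, ∀ n ≥ N, supNorm (f - D.sigma g n f) ≤ ε := by
  obtain ⟨m, hm⟩ := hg.almost_disjoint
  have hC_top : 1 + (C : ℝ≥0∞) ≠ ∞ := by finiteness
  obtain ⟨P, hP, hfP⟩ := hf (ε / (1 + C)) (ENNReal.div_pos hε.ne' hC_top)
  obtain ⟨N, hN⟩ := exists_mem_polys hg hP
  refine ⟨N + m, fun n hn => (supNorm_sub_sigma_le hg hm hC hf hn hN).trans ?_⟩
  calc (1 + C) * supNorm (f - P) ≤ (1 + C) * (ε / (1 + C)) := by gcongr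
    _ = ε := ENNReal.mul_div_cancel (by simp) hC_top

lemma sigma_add (g : ℕ → ℕ × ℕ → ℝ) (f : D.G → ℝ) (n N : ℕ) :
    D.sigma g (n + N) f = D.sigma g n f + ∑ i ∈ Finset.range N, D.tau g (n + (i + 1)) f := by
  induction N with
  | zero => rw [Finset.sum_range_zero, add_zero, add_zero]
  | succ N ih =>
    rw [Finset.sum_range_succ, ← add_assoc (D.sigma g n f), ← ih, ← add_assoc n N 1, tau,
      add_sub_cancel]

lemma supNorm_sub_sigma_le_tsum (hg : IsAdmissible D.Omega g)
    (hC : ∀ n, ∀ f ∈ D.F, supNorm (D.sigma g n f) ≤ C * supNorm f) (hf : f ∈ D.F) (n : ℕ) :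
    supNorm (f - D.sigma g n f) ≤ ∑' i, supNorm (D.tau g (n + i) f) := by
  refine ENNReal.le_of_forall_pos_le_add fun ε hε _ => ?_
  obtain ⟨N, hN⟩ := exists_supNorm_sub_sigma_le hg hC hf (ENNReal.coe_pos.2 hε)
  calc supNorm (f - D.sigma g n f)
      = supNorm (∑ i ∈ Finset.range N, D.tau g (n + (i + 1)) f + (f - D.sigma g (n + N) f)) := by
        rw [sigma_add]
        congr 1
        abel
    _ ≤ ∑ i ∈ Finset.range N, supNorm (D.tau g (n + (i + 1)) f) + ε :=
        (supNorm_add_le _ _).trans (add_le_add (supNorm_sum_le _ _) (hN _ (Nat.le_add_left N n)))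
    _ ≤ ∑' i, supNorm (D.tau g (n + (i + 1)) f) + ε := by
        gcongr
        exact ENNReal.sum_le_tsum _
    _ ≤ ∑' i, supNorm (D.tau g (n + i) f) + ε :=
        add_le_add (ENNReal.tsum_comp_le_tsum_of_injective (add_left_injective 1)
          fun i => supNorm (D.tau g (n + i) f)) le_rfl

lemma supNorm_tau_le (hC : ∀ n, ∀ f ∈ D.F, supNorm (D.sigma g n f) ≤ C * supNorm f)
    (hf : f ∈ D.F) (j : ℕ) : supNorm (D.tau g j f) ≤ 2 * C * supNorm f := by
  rw [mul_assoc, two_mul]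
  cases j with
  | zero => exact (hC 0 f hf).trans le_self_add
  | succ j => exact (supNorm_sub_le _ _).trans (add_le_add (hC _ f hf) (hC _ f hf))

lemma supNorm_tau_succ_le_tsum (g : ℕ → ℕ × ℕ → ℝ) (f : D.G → ℝ) (j : ℕ) :
    supNorm (D.tau g (j + 1) f) ≤ ∑' i, supNorm (f - D.sigma g (j + i) f) :=
  calc supNorm (D.tau g (j + 1) f)
      = supNorm ((f - D.sigma g j f) - (f - D.sigma g (j + 1) f)) := by
        rw [tau, sub_sub_sub_cancel_left]
    _ ≤ supNorm (f - D.sigma g j f) + supNorm (f - D.sigma g (j + 1) f) := supNorm_sub_le _ _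
    _ = ∑ i ∈ Finset.range 2, supNorm (f - D.sigma g (j + i) f) := by
        rw [Finset.sum_range_succ, Finset.sum_range_one, add_zero]
    _ ≤ ∑' i, supNorm (f - D.sigma g (j + i) f) := ENNReal.sum_le_tsum _

end DigraphRep

/-! ### Derivatives and the `K`-functional -/

section Multiplier

variable {Ω : Set (ℕ × ℕ)} {g : ℕ → ℕ × ℕ → ℝ} {μ : ℕ × ℕ → ℝ}

lemma restrictTo_of_ne_zero {j : ℕ} {k : ℕ × ℕ} (h : g j k ≠ 0) : restrictTo g μ j k = μ k :=
  Set.indicator_of_mem (s := Function.support (g j)) h μ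

lemma restrictTo_mul (g : ℕ → ℕ × ℕ → ℝ) (μ : ℕ × ℕ → ℝ) (j : ℕ) :
    restrictTo g μ j * g j = μ * g j := by
  ext k
  by_cases h : g j k = 0
  · simp only [Pi.mul_apply, h, mul_zero]
  · rw [Pi.mul_apply, restrictTo_of_ne_zero h, Pi.mul_apply]

lemma IsAdmissible.finite_support_restrictTo (hg : IsAdmissible Ω g) (μ : ℕ × ℕ → ℝ) (j : ℕ) :
    (Function.support (restrictTo g μ j)).Finite :=
  (hg.finite_support j).subset Set.support_indicator_subset

lemma IsAdmissible.finite_support_recip_restrictTo (hg : IsAdmissible Ω g) (μ : ℕ × ℕ → ℝ)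
    (j : ℕ) : (Function.support (recip (restrictTo g μ j))).Finite :=
  (hg.finite_support_restrictTo μ j).subset fun _ hk h => hk (inv_eq_zero.2 h)

lemma IsAdmissible.finite_support_mul_partialSum (hg : IsAdmissible Ω g) (μ : ℕ × ℕ → ℝ)
    (n : ℕ) : (Function.support (μ * partialSum g n)).Finite :=
  (hg.finite_support_partialSum n).subset (Function.support_mul_subset_right _ _)

lemma IsMultiplier.pos_of_mem {r : ℕ} (hμ : IsMultiplier Ω g r μ) {k : ℕ × ℕ} (hk : k ∈ Ω) :
    0 < μ k :=
  hμ.pos k ⟨k, hk, by simp, by simp⟩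

end Multiplier

lemma tsum_inv_two_pow_le {r : ℕ} (hr : 1 ≤ r) (n : ℕ) :
    ∑' i : ℕ, ((2 : ℝ≥0∞) ^ ((n + i) * r))⁻¹ ≤ 2 * (2 ^ (n * r))⁻¹ :=
  calc ∑' i : ℕ, ((2 : ℝ≥0∞) ^ ((n + i) * r))⁻¹
      ≤ ∑' i : ℕ, (2⁻¹ : ℝ≥0∞) ^ i * (2 ^ (n * r))⁻¹ := by
        refine ENNReal.tsum_le_tsum fun i => ?_
        rw [add_mul, pow_add, ENNReal.mul_inv (by simp) (by simp), mul_comm, ENNReal.inv_pow]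
        gcongr ?_ * _
        exact pow_le_pow_right_of_le_one' (ENNReal.inv_le_one.2 one_le_two)
          (Nat.le_mul_of_pos_right i hr)
    _ = 2 * (2 ^ (n * r))⁻¹ := by
        rw [ENNReal.tsum_mul_right, ENNReal.tsum_geometric, ENNReal.one_sub_inv_two, inv_inv]

lemma ofReal_inv_two_pow (n r : ℕ) :
    ENNReal.ofReal (((2 : ℝ)⁻¹ ^ n) ^ r) = ((2 : ℝ≥0∞) ^ (n * r))⁻¹ := by
  rw [← pow_mul, ENNReal.ofReal_pow (by positivity), ENNReal.ofReal_inv_of_pos two_pos,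
    ENNReal.ofReal_ofNat, ENNReal.inv_pow]

namespace DigraphRep

variable {D : DigraphRep} {g : ℕ → ℕ × ℕ → ℝ} {C : ℝ≥0} {f u u' : D.G → ℝ} {r : ℕ}
  {μ : ℕ × ℕ → ℝ} {ρ : ℝ≥0∞} {γ : ℝ}

lemma tau_eq_tau_mult_recip (hg : IsAdmissible D.Omega g) (hμ : IsMultiplier D.Omega g r μ)
    (hu : D.IsDerivative μ u u') (j : ℕ) :
    D.tau g j u = D.tau g j (D.mult (recip (restrictTo g μ j)) u') := by
  rw [tau_eq_mult hg, tau_eq_mult hg]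
  refine mult_congr fun k => ?_
  rw [coeff_mult (hg.finite_support_recip_restrictTo μ j), hu k]
  by_cases h : g j k = 0
  · rw [h, zero_mul, zero_mul]
  · have hk := hμ.pos_of_mem (D.Omega_eq_univ ▸ Set.mem_univ k)
    rw [recip, restrictTo_of_ne_zero h, inv_mul_cancel_left₀ hk.ne']

lemma exists_supNorm_tau_le_derivative (hg : IsAdmissible D.Omega g)
    (hμ : IsMultiplier D.Omega g r μ)
    (hC : ∀ n, ∀ f ∈ D.F, supNorm (D.sigma g n f) ≤ C * supNorm f) :
    ∃ A : ℝ≥0, ∀ u, ∀ u' ∈ D.F, D.IsDerivative μ u u' → ∀ j,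
      supNorm (D.tau g j u) ≤ A * (2 ^ (j * r))⁻¹ * supNorm u' := by
  obtain ⟨c, _, hc, hcC⟩ := hμ.equiv
  refine ⟨2 * C * (9 * c⁻¹), fun u u' hu' hd j => ?_⟩
  have hV : variation (recip (restrictTo g μ j)) ≤ (c : ℝ≥0∞)⁻¹ * (2 ^ (j * r))⁻¹ := by
    rw [← ENNReal.mul_inv (Or.inl (by simpa using hc.ne')) (Or.inl ENNReal.coe_ne_top)]
    exact ENNReal.le_inv_iff_le_inv.1 (hcC j).2.2.1
  have h_fin := hg.finite_support_recip_restrictTo μ j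
  calc supNorm (D.tau g j u)
      ≤ 2 * C * supNorm (D.mult (recip (restrictTo g μ j)) u') := by
        rw [tau_eq_tau_mult_recip hg hμ hd j]
        exact supNorm_tau_le hC (mult_mem_F h_fin u') j
    _ ≤ 2 * C * (9 * ((c : ℝ≥0∞)⁻¹ * (2 ^ (j * r))⁻¹) * supNorm u') := by
        gcongr
        exact (supNorm_mult_le h_fin hu').trans (by gcongr)
    _ = ↑(2 * C * (9 * c⁻¹)) * (2 ^ (j * r))⁻¹ * supNorm u' := by
        push_cast [ENNReal.coe_inv hc.ne']
        ring

lemma supNorm_sub_sigma_le_derivative (hg : IsAdmissible D.Omega g) (hr : 1 ≤ r)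
    (hC : ∀ n, ∀ f ∈ D.F, supNorm (D.sigma g n f) ≤ C * supNorm f) {A : ℝ≥0} (hu : u ∈ D.F)
    (hA : ∀ j, supNorm (D.tau g j u) ≤ A * (2 ^ (j * r))⁻¹ * supNorm u') (n : ℕ) :
    supNorm (u - D.sigma g n u) ≤ A * 2 * ((2 ^ (n * r))⁻¹ * supNorm u') :=
  calc supNorm (u - D.sigma g n u)
      ≤ ∑' i, supNorm (D.tau g (n + i) u) := supNorm_sub_sigma_le_tsum hg hC hu n
    _ ≤ ∑' i : ℕ, A * ((2 : ℝ≥0∞) ^ ((n + i) * r))⁻¹ * supNorm u' :=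
        ENNReal.tsum_le_tsum fun i => hA (n + i)
    _ ≤ A * (2 * (2 ^ (n * r))⁻¹) * supNorm u' := by
        rw [ENNReal.tsum_mul_right, ENNReal.tsum_mul_left]
        gcongr
        exact tsum_inv_two_pow_le hr n
    _ = A * 2 * ((2 ^ (n * r))⁻¹ * supNorm u') := by ring

lemma exists_degApprox_le_kFunctional (hg : IsAdmissible D.Omega g) (hr : 1 ≤ r)
    (hμ : IsMultiplier D.Omega g r μ)
    (hC : ∀ n, ∀ f ∈ D.F, supNorm (D.sigma g n f) ≤ C * supNorm f) :
    ∃ A : ℝ≥0, ∀ f n, D.degApprox g n f ≤ A * D.kFunctional μ r f (2⁻¹ ^ n) := by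
  obtain ⟨A, hA⟩ := exists_supNorm_tau_le_derivative hg hμ hC
  refine ⟨1 + A * 2, fun f n => ?_⟩
  push_cast
  have hA_top : 1 + (A : ℝ≥0∞) * 2 ≠ ∞ := by finiteness
  simp only [kFunctional, ENNReal.mul_iInf_of_ne (by simp) hA_top, ofReal_inv_two_pow]
  refine le_iInf₂ fun u hu => le_iInf₂ fun u' hu' => le_iInf fun hd => ?_
  calc D.degApprox g n f ≤ supNorm (f - D.sigma g n u) :=
        degApprox_le_of_mem (sigma_mem_polys hg n u) f
    _ ≤ supNorm (f - u) + supNorm (u - D.sigma g n u) := by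
        rw [← sub_add_sub_cancel f u]
        exact supNorm_add_le _ _
    _ ≤ supNorm (f - u) + A * 2 * ((2 ^ (n * r))⁻¹ * supNorm u') := by
        gcongr
        exact supNorm_sub_sigma_le_derivative hg hr hC hu (hA u u' hu' hd) n
    _ ≤ (1 + A * 2) * (supNorm (f - u) + (2 ^ (n * r))⁻¹ * supNorm u') := by
        rw [mul_add]
        gcongr
        · exact le_mul_of_one_le_left' le_self_add
        · exact le_add_self

/-- The derivative of `σ_n(f)`, the near-optimal choice of `𝒟u` in the `K`-functional of `f`. -/
def sigmaDeriv (D : DigraphRep) (g : ℕ → ℕ × ℕ → ℝ) (μ : ℕ × ℕ → ℝ) (n : ℕ) (f : D.G → ℝ) :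
    D.G → ℝ := D.mult (μ * partialSum g n) f

lemma isDerivative_sigmaDeriv (hg : IsAdmissible D.Omega g) (μ : ℕ × ℕ → ℝ) (n : ℕ)
    (f : D.G → ℝ) : D.IsDerivative μ (D.sigma g n f) (D.sigmaDeriv g μ n f) := fun k => by
  rw [sigmaDeriv, coeff_mult (hg.finite_support_mul_partialSum μ n), sigma_eq_mult,
    coeff_mult (hg.finite_support_partialSum n), Pi.mul_apply, mul_assoc]

lemma sigmaDeriv_eq_sum (hg : IsAdmissible D.Omega g) (μ : ℕ × ℕ → ℝ) (n : ℕ) (f : D.G → ℝ) :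
    D.sigmaDeriv g μ n f =
      ∑ j ∈ Finset.range (n + 1), D.mult (restrictTo g μ j) (D.tau g j f) := by
  have h_fin (j : ℕ) : (Function.support (μ * g j)).Finite :=
    (hg.finite_support j).subset (Function.support_mul_subset_right _ _)
  rw [sigmaDeriv, partialSum_eq_sum, Finset.mul_sum, mult_sum_left _ fun j _ => h_fin j]
  refine Finset.sum_congr rfl fun j _ => ?_
  rw [tau_eq_mult hg, mult_mult (hg.finite_support j), restrictTo_mul]

lemma exists_supNorm_sigmaDeriv_le (hg : IsAdmissible D.Omega g)
    (hμ : IsMultiplier D.Omega g r μ) :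
    ∃ A : ℝ≥0, ∀ (f : D.G → ℝ) (n : ℕ), supNorm (D.sigmaDeriv g μ n f) ≤
      A * ∑ j ∈ Finset.range (n + 1), 2 ^ (j * r) * supNorm (D.tau g j f) := by
  obtain ⟨_, B, _, hB⟩ := hμ.equiv
  refine ⟨9 * B, fun f n => ?_⟩
  rw [sigmaDeriv_eq_sum hg, Finset.mul_sum]
  refine (supNorm_sum_le _ _).trans (Finset.sum_le_sum fun j _ => ?_)
  calc supNorm (D.mult (restrictTo g μ j) (D.tau g j f))
      ≤ 9 * variation (restrictTo g μ j) * supNorm (D.tau g j f) :=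
        supNorm_mult_le (hg.finite_support_restrictTo μ j) (tau_mem_F hg j f)
    _ ≤ 9 * (B * 2 ^ (j * r)) * supNorm (D.tau g j f) := by gcongr; exact (hB j).2.1
    _ = ↑(9 * B) * (2 ^ (j * r) * supNorm (D.tau g j f)) := by push_cast; ring

lemma kFunctional_le (hg : IsAdmissible D.Omega g) (μ : ℕ × ℕ → ℝ) (r n : ℕ) (f : D.G → ℝ) :
    D.kFunctional μ r f (2⁻¹ ^ n) ≤
      supNorm (f - D.sigma g n f) + (2 ^ (n * r))⁻¹ * supNorm (D.sigmaDeriv g μ n f) := by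
  rw [kFunctional, ofReal_inv_two_pow]
  exact iInf₂_le_of_le _ (sigma_mem_F hg n f) <| iInf₂_le_of_le _
    (mult_mem_F (hg.finite_support_mul_partialSum μ n) f) <|
    iInf_le _ (isDerivative_sigmaDeriv hg μ n f)

theorem sub_sigma_mem_seqSpace_of_mem_besov (hg : IsAdmissible D.Omega g)
    (hC : ∀ n, ∀ f ∈ D.F, supNorm (D.sigma g n f) ≤ C * supNorm f) (hρ : 0 < ρ)
    (h : f ∈ D.besov g ρ γ) : (fun n => supNorm (f - D.sigma g n f)) ∈ seqSpace ρ γ := by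
  obtain ⟨m, hm⟩ := hg.almost_disjoint
  exact mem_seqSpace_of_shift_le (C := 1 + C) hρ m
    (fun n => supNorm_lt_top_of_mem_F (sub_mem_F h.1 (sigma_mem_F hg n f))) h.2
    fun n => by simpa using supNorm_sub_sigma_le_degApprox hg hm hC h.1 n

theorem mem_besov_of_sub_sigma_mem_seqSpace (hg : IsAdmissible D.Omega g) (hρ : 0 < ρ)
    (hf : f ∈ D.F) (h : (fun n => supNorm (f - D.sigma g n f)) ∈ seqSpace ρ γ) :
    f ∈ D.besov g ρ γ :=
  ⟨hf, mem_seqSpace_of_le (C := 1) hρ h fun n => by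
    simpa using degApprox_le_of_mem (sigma_mem_polys hg n f) f⟩

theorem tau_mem_seqSpace_of_sub_sigma_mem_seqSpace (hg : IsAdmissible D.Omega g) (hρ : 0 < ρ)
    (hγ : 0 < γ) (h : (fun n => supNorm (f - D.sigma g n f)) ∈ seqSpace ρ γ) :
    (fun j => supNorm (D.tau g j f)) ∈ seqSpace ρ γ := by
  have h_succ : (fun j => supNorm (D.tau g (j + 1) f)) ∈ seqSpace ρ γ :=
    mem_seqSpace_of_le_tsum_add (C := 1) hρ hγ h fun j => by
      simpa using supNorm_tau_succ_le_tsum g f j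
  exact mem_seqSpace_of_shift_le (C := 1) hρ 1
    (fun j => supNorm_lt_top_of_mem_F (tau_mem_F hg j f)) h_succ fun j => by simp

theorem sub_sigma_mem_seqSpace_of_tau_mem_seqSpace (hg : IsAdmissible D.Omega g)
    (hC : ∀ n, ∀ f ∈ D.F, supNorm (D.sigma g n f) ≤ C * supNorm f) (hρ : 0 < ρ) (hγ : 0 < γ)
    (hf : f ∈ D.F) (h : (fun j => supNorm (D.tau g j f)) ∈ seqSpace ρ γ) :
    (fun n => supNorm (f - D.sigma g n f)) ∈ seqSpace ρ γ :=
  mem_seqSpace_of_le_tsum_add (C := 1) hρ hγ h fun n => by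
    simpa using supNorm_sub_sigma_le_tsum hg hC hf n

theorem kFunctional_mem_seqSpace (hg : IsAdmissible D.Omega g) (hμ : IsMultiplier D.Omega g r μ)
    (hρ : 0 < ρ) (hγr : γ < r) (h_tau : (fun j => supNorm (D.tau g j f)) ∈ seqSpace ρ γ)
    (h_sub : (fun n => supNorm (f - D.sigma g n f)) ∈ seqSpace ρ γ) :
    (fun j : ℕ => D.kFunctional μ r f (2⁻¹ ^ j)) ∈ seqSpace ρ γ := by
  obtain ⟨A, hA⟩ := exists_supNorm_sigmaDeriv_le hg hμ
  have h_deriv : (fun n : ℕ => ((2 : ℝ≥0∞) ^ (n * r))⁻¹ * supNorm (D.sigmaDeriv g μ n f)) ∈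
      seqSpace ρ γ := mem_seqSpace_of_le_sum_range hρ hγr h_tau fun n => by
    rw [ENNReal.mul_inv_cancel_left (by simp) (by simp)]
    exact hA f n
  exact mem_seqSpace_of_le (C := 1) hρ (add_mem_seqSpace hρ h_sub h_deriv) fun n => by
    simpa using kFunctional_le hg μ r n f

theorem mem_besov_of_kFunctional_mem_seqSpace (hg : IsAdmissible D.Omega g)
    (hμ : IsMultiplier D.Omega g r μ) (hr : 1 ≤ r)
    (hC : ∀ n, ∀ f ∈ D.F, supNorm (D.sigma g n f) ≤ C * supNorm f) (hρ : 0 < ρ) (hf : f ∈ D.F)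
    (h : (fun j : ℕ => D.kFunctional μ r f (2⁻¹ ^ j)) ∈ seqSpace ρ γ) : f ∈ D.besov g ρ γ := by
  obtain ⟨A, hA⟩ := exists_degApprox_le_kFunctional hg hr hμ hC
  exact ⟨hf, mem_seqSpace_of_le hρ h (hA f)⟩

end DigraphRep

end DigraphHarmonic

end

open DigraphHarmonic DigraphHarmonic.DigraphRep

theorem mainTheorem3 (D : DigraphHarmonic.DigraphRep)
    (g : ℕ → ℕ × ℕ → ℝ) (hg : DigraphHarmonic.IsAdmissible D.Omega g)
    (hH : ∃ C : ℝ≥0, ∀ n ≥ 1,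
      DigraphHarmonic.variation (DigraphHarmonic.partialSum g n) ≤ C)
    (r : ℕ) (hr : 1 ≤ r) (μ : ℕ × ℕ → ℝ)
    (hμ : DigraphHarmonic.IsMultiplier D.Omega g r μ)
    (ρ : ℝ≥0∞) (hρ : 0 < ρ) (γ : ℝ) (hγ : 0 < γ)
    (f : D.G → ℝ) (hf : f ∈ D.F) :
    List.TFAE [
      f ∈ D.besov g ρ γ,
      (fun j => DigraphHarmonic.supNorm (D.tau g j f)) ∈ DigraphHarmonic.seqSpace ρ γ,
      (fun n => DigraphHarmonic.supNorm (f - D.sigma g n f)) ∈ DigraphHarmonic.seqSpace ρ γ] ∧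
    (γ < r →
      (f ∈ D.besov g ρ γ ↔
        (fun j : ℕ => D.kFunctional μ r f (2⁻¹ ^ j)) ∈ DigraphHarmonic.seqSpace ρ γ)) := by
  obtain ⟨C, hC⟩ := exists_forall_supNorm_sigma_le hg hH
  have sub_sigma_of_besov := sub_sigma_mem_seqSpace_of_mem_besov (f := f) (γ := γ) hg hC hρ
  have tau_of_sub_sigma := tau_mem_seqSpace_of_sub_sigma_mem_seqSpace (f := f) hg hρ hγ
  refine ⟨?_, fun hγr => ⟨fun h => ?_, mem_besov_of_kFunctional_mem_seqSpace hg hμ hr hC hρ hf⟩⟩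
  · tfae_have 1 → 3 := sub_sigma_of_besov
    tfae_have 3 → 1 := mem_besov_of_sub_sigma_mem_seqSpace hg hρ hf
    tfae_have 3 → 2 := tau_of_sub_sigma
    tfae_have 2 → 3 := sub_sigma_mem_seqSpace_of_tau_mem_seqSpace hg hC hρ hγ hf
    tfae_finish
  · have h_sub := sub_sigma_of_besov h
    exact kFunctional_mem_seqSpace hg hμ hρ hγr (tau_of_sub_sigma h_sub) h_sub
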